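/- **Setting.** Structures are finite. An ECSP instance $(\mathcal A,\mathcal B,O)$ consists of an $\ell$-structure $\mathcal A$ (the variables are its elements), an $r$-structure $\mathcal B$ over the same vocabulary $\tau$ with non-empty universe, and a set $O\subseteq A$ of output variables; $\mathcal A^{\mathcal B}[O]$ is the set of restrictions to $O$ of the homomorphisms $\mathcal A\to\mathcal B$ (for $O=\emptyset$ it contains just the empty map if there is a homomorphism, and nothing otherwise). The vocabulary may contain, for a variable $X$, a distinguished unary symbol $\mathit{dom}(X)$, which is then interpreted in $\mathcal A$ by $\{\langle X\rangle\}$; such an $X$ is called domain restricted. The domain-restricted version $(\mathcal A^\circ,\mathcal B^\circ,O)$ of the instance is obtained by adding, for each $X\in O$ that is not domain restricted, the constraint $\mathit{dom}(X)$, with $\mathit{dom}(X)^{\mathcal A^\circ}=\{\langle X\rangle\}$ and with $\mathit{dom}(X)^{\mathcal B^\circ}$ the values of $X$ in the relation of the first constraint in which $X$ occurs (all of $B$, if there is none). So $\mathcal A^\circ=\mathcal A$ if all variables in $O$ are domain restricted. A *$v$-structure* for $\mathcal A$ is a finite family of views, each one a tuple of variables of $\mathcal A$, such that for every $R\in\tau$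 and $t\in R^{\mathcal A}$ some view with tuple $t$ is a base view for $(R,t)$. An $r$-structure that gives a relation to each view is *legal* for $(\mathcal A,\mathcal B)$ if the relation of a view with tuple $w$ contains $\mathcal A^{\mathcal B}[w]$, and the relation of a base view for $(R,t)$ is contained in $R^{\mathcal B}$. A *decomposition method* DM is a pair of polynomial-time computable functions that map every $\mathcal A$ to a $v$-structure $\ell\text{-DM}(\mathcal A)$ and every $(\mathcal A,\mathcal B)$ to a legal $r$-structure $r\text{-DM}(\mathcal A,\mathcal B)$ over it. The hypergraph of a structure has one hyperedge for each tuple, namely the set of its variables (for a $v$-structure, one for each view). We write $\mathcal H_1\le\mathcal H_2$ if each hyperedge of $\mathcal H_1$ is contained in one of $\mathcal H_2$; $(\mathcal H_1,\mathcal H_2)$ has a *tree projection* if $\mathcal H_1\le\mathcal H_a\le\mathcal H_2$ for some hypergraph $\mathcal H_a$ with a join tree. A *core* of a structure is a substructure (not necessarily induced) to which the structure maps homomorphically and no proper substructure of which has this property. $(\mathcal A,O)$ is *tp-covered by a $v$-structure* $\mathcal A_{\mathcal V}$ if for some core $\mathcal A'$ of $\mathcal A\uplus\biguplus_{X\in O}\mathbb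 S_{\{X\}}$ the pair $(\mathcal H_{\mathcal A'},\mathcal H_{\mathcal A_{\mathcal V}})$ has a tree projection; here $\mathbb S_{\{X\}}$ has the single element $X$, a fresh unary symbol, and the single tuple $\langle X\rangle$. $(\mathcal A,O)$ is *tp-covered through DM* if it is tp-covered by $\ell\text{-DM}(\mathcal A)$. **Algorithm** $\mathtt{ComputeAllSolutions}_{\mathrm{DM}}$, on input $(\mathcal A,\mathcal B,O)$ with $O=\{X_1,\dots,X_m\}$. Compute $(\mathcal A^\circ,\mathcal B^\circ,O)$, $\mathcal A_{\mathcal V}=\ell\text{-DM}(\mathcal A^\circ)$ and $\mathcal B_{\mathcal V}=r\text{-DM}(\mathcal A^\circ,\mathcal B^\circ)$, and call $\mathtt{Propagate}(1,\mathcal B_{\mathcal V},\langle\rangle)$. The procedure $\mathtt{Propagate}(i,\mathcal B_{\mathcal V},\langle a_1,\dots,a_{i-1}\rangle)$ enforces generalized arc consistency: it deletes tuples from the relations of the views until each tuple of each view agrees, on the common variables, with some tuple of every view. Then, for each value $a_i$ that remains in the relation of the base view for $\mathit{dom}(X_i)$, it outputs $\langle a_1,\dots,a_m\rangle$ if $i=m$;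 otherwise it replaces this relation by $\{\langle a_i\rangle\}$ and calls $\mathtt{Propagate}(i+1,\cdot,\langle a_1,\dots,a_i\rangle)$ on the result. (If $m=0$, it outputs the empty tuple provided that all relations are non-empty after enforcing consistency.) **Theorem.** For every decomposition method DM there is a polynomial $p$ such that the following holds for every ECSP instance $(\mathcal A,\mathcal B,O)$, of size $n$. If $(\mathcal A,O)$ is tp-covered by the $v$-structure $\ell\text{-DM}(\mathcal A^\circ)$ that the algorithm uses (when all variables in $O$ are domain restricted, this says precisely that $(\mathcal A,O)$ is tp-covered through DM), then $\mathtt{ComputeAllSolutions}_{\mathrm{DM}}$ on input $(\mathcal A,\mathcal B,O)$ halts and outputs exactly the elements of $\mathcal A^{\mathcal B}[O]$, each one exactly once, with polynomial delay: if $\mathcal A^{\mathcal B}[O]=\emptyset$, it halts without output within $p(n)$ steps; otherwise the first output comes within $p(n)$ steps, each further output within $p(n)$ steps after the previous one, and the algorithm halts within $p(n)$ steps after the last one. (Steps are those of programs in a first-order functional language with recursive procedures on finite binary trees, where copying, building or outputting a tree costs its number of nodes, and every other basic operation costs one step. The polynomial-time procedures for DM are programs of the same kind.) -/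

import Mathlib

namespace ECSP

/-! ## Symbolic data and a machine model with step counts -/

/-- Finite binary trees, the data on which programs run. -/
inductive Data : Type
  | nil : Data
  | cons : Data → Data → Data
  deriving DecidableEq

namespace Data

/-- Number of nodes of a tree. -/
def size : Data → ℕ
  | nil => 1
  | cons a b => 1 + size a + size b

/-- The truth value `true`; the truth value `false` is `nil`. -/
def tt : Data := cons nil nil

/-- A list of trees as one tree. -/
def ofList : List Data → Data
  | [] => nil
  | a :: l => cons a (ofList l)

end Data

/-- Expressions of a first-order functional language with recursive procedures. Variables are
numbered, `F` is the type of procedure names, and every procedure has one argument. -/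
inductive Exp (F : Type) : Type
  | var (x : ℕ) : Exp F
  | nil : Exp F
  | cons (a b : Exp F) : Exp F
  /-- equality test of two trees -/
  | eq (a b : Exp F) : Exp F
  | ite (c a b : Exp F) : Exp F
  /-- `let x := e in b` -/
  | letE (x : ℕ) (e b : Exp F) : Exp F
  /-- `match e with | nil => n | cons x y => c` -/
  | caseE (e n : Exp F) (x y : ℕ) (c : Exp F) : Exp F
  /-- call of a procedure -/
  | call (f : F) (e : Exp F) : Exp F
  /-- write the value of `e` to the output -/
  | emit (e : Exp F) : Exp F

/-- Renaming of procedures. -/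
def Exp.map {F G : Type} (g : F → G) : Exp F → Exp G
  | var x => var x
  | nil => nil
  | cons a b => cons (map g a) (map g b)
  | eq a b => eq (map g a) (map g b)
  | ite c a b => ite (map g c) (map g a) (map g b)
  | letE x e b => letE x (map g e) (map g b)
  | caseE e n x y c => caseE (map g e) (map g n) x y (map g c)
  | call f e => call (g f) (map g e)
  | emit e => emit (map g e)

/-- The history of a run: `none` is one unit of time, `some d` is the output of `d`. -/
abbrev Trace : Type := List (Option Data)

/-- `k` units of time. -/
def ticks (k : ℕ) : Trace := List.replicate k none

/-- `Eval code env e v t`: in the environment `env`, the evaluation of `e` halts with the value `v`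
and with the history `t`, where `code f` is the body of procedure `f`. The argument of a procedure
is in variable `0` when its body starts. Copying or building a tree costs as many units of time
as the tree has nodes, every other basic step costs one unit. -/
inductive Eval {F : Type} (code : F → Exp F) : (ℕ → Data) → Exp F → Data → Trace → Prop
  | var (env : ℕ → Data) (x : ℕ) :
      Eval code env (.var x) (env x) (ticks (env x).size)
  | nil (env : ℕ → Data) :
      Eval code env .nil .nil (ticks 1)
  | cons {env : ℕ → Data} {a b : Exp F} {u v : Data} {s t : Trace} :
      Eval code env a u s → Eval code env b v t →
      Eval code env (.cons a b) (.cons u v) (s ++ t ++ ticks (Data.cons u v).size)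
  | eq {env : ℕ → Data} {a b : Exp F} {u v : Data} {s t : Trace} :
      Eval code env a u s → Eval code env b v t →
      Eval code env (.eq a b) (if u = v then Data.tt else Data.nil) (s ++ t ++ ticks 1)
  | ite_false {env : ℕ → Data} {c a b : Exp F} {v : Data} {s t : Trace} :
      Eval code env c .nil s → Eval code env b v t →
      Eval code env (.ite c a b) v (s ++ ticks 1 ++ t)
  | ite_true {env : ℕ → Data} {c a b : Exp F} {u w v : Data} {s t : Trace} :
      Eval code env c (.cons u w) s → Eval code env a v t →
      Eval code env (.ite c a b) v (s ++ ticks 1 ++ t)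
  | letE {env : ℕ → Data} {x : ℕ} {e b : Exp F} {u v : Data} {s t : Trace} :
      Eval code env e u s → Eval code (Function.update env x u) b v t →
      Eval code env (.letE x e b) v (s ++ ticks 1 ++ t)
  | case_nil {env : ℕ → Data} {e n : Exp F} {x y : ℕ} {c : Exp F} {v : Data} {s t : Trace} :
      Eval code env e .nil s → Eval code env n v t →
      Eval code env (.caseE e n x y c) v (s ++ ticks 1 ++ t)
  | case_cons {env : ℕ → Data} {e n : Exp F} {x y : ℕ} {c : Exp F} {u w v : Data} {s t : Trace} :
      Eval code env e (.cons u w) s →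
      Eval code (Function.update (Function.update env x u) y w) c v t →
      Eval code env (.caseE e n x y c) v (s ++ ticks 1 ++ t)
  | call {env : ℕ → Data} {f : F} {e : Exp F} {u v : Data} {s t : Trace} :
      Eval code env e u s →
      Eval code (Function.update (fun _ => Data.nil) 0 u) (code f) v t →
      Eval code env (.call f e) v (s ++ ticks 1 ++ t)
  | emit {env : ℕ → Data} {e : Exp F} {u : Data} {s : Trace} :
      Eval code env e u s →
      Eval code env (.emit e) .nil (s ++ some u :: ticks 1)

/-- A run of procedure `f` on the argument `d`. -/
def Run {F : Type} (code : F → Exp F) (f : F) (d v : Data) (t : Trace) : Prop :=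
  Eval code (Function.update (fun _ => Data.nil) 0 d) (code f) v t

/-- Evaluation is deterministic, so that one may speak of the run of a program. -/
theorem Eval.det {F : Type} {code : F → Exp F} {env : ℕ → Data} {e : Exp F} {v v' : Data}
    {t t' : Trace} (h : Eval code env e v t) (h' : Eval code env e v' t') : v = v' ∧ t = t' := by
  induction h generalizing v' t' with
  | var => cases h'; exact ⟨rfl, rfl⟩
  | nil => cases h'; exact ⟨rfl, rfl⟩
  | cons _ _ ih₁ ih₂ =>
    cases h' with
    | cons a b => obtain ⟨rfl, rfl⟩ := ih₁ a; obtain ⟨rfl, rfl⟩ := ih₂ b; exact ⟨rfl, rfl⟩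
  | eq _ _ ih₁ ih₂ =>
    cases h' with
    | eq a b => obtain ⟨rfl, rfl⟩ := ih₁ a; obtain ⟨rfl, rfl⟩ := ih₂ b; exact ⟨rfl, rfl⟩
  | ite_false _ _ ih₁ ih₂ =>
    cases h' with
    | ite_false a b => obtain ⟨_, rfl⟩ := ih₁ a; obtain ⟨rfl, rfl⟩ := ih₂ b; exact ⟨rfl, rfl⟩
    | ite_true a b => exact absurd (ih₁ a).1 (by simp)
  | ite_true _ _ ih₁ ih₂ =>
    cases h' with
    | ite_false a b => exact absurd (ih₁ a).1 (by simp)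
    | ite_true a b => obtain ⟨_, rfl⟩ := ih₁ a; obtain ⟨rfl, rfl⟩ := ih₂ b; exact ⟨rfl, rfl⟩
  | letE _ _ ih₁ ih₂ =>
    cases h' with
    | letE a b => obtain ⟨rfl, rfl⟩ := ih₁ a; obtain ⟨rfl, rfl⟩ := ih₂ b; exact ⟨rfl, rfl⟩
  | case_nil _ _ ih₁ ih₂ =>
    cases h' with
    | case_nil a b => obtain ⟨_, rfl⟩ := ih₁ a; obtain ⟨rfl, rfl⟩ := ih₂ b; exact ⟨rfl, rfl⟩
    | case_cons a b => exact absurd (ih₁ a).1 (by simp)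
  | case_cons _ _ ih₁ ih₂ =>
    cases h' with
    | case_nil a b => exact absurd (ih₁ a).1 (by simp)
    | case_cons a b =>
      obtain ⟨h, rfl⟩ := ih₁ a
      cases h
      obtain ⟨rfl, rfl⟩ := ih₂ b
      exact ⟨rfl, rfl⟩
  | call _ _ ih₁ ih₂ =>
    cases h' with
    | call a b => obtain ⟨rfl, rfl⟩ := ih₁ a; obtain ⟨rfl, rfl⟩ := ih₂ b; exact ⟨rfl, rfl⟩
  | emit _ ih₁ =>
    cases h' with
    | emit a => obtain ⟨rfl, rfl⟩ := ih₁ a; exact ⟨rfl, rfl⟩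

/-- Procedure `f` computes the value `v` on the argument `d` within `T` units of time, silently. -/
def ComputesWithin {F : Type} (code : F → Exp F) (f : F) (d v : Data) (T : ℕ) : Prop :=
  ∃ k ≤ T, Run code f d v (ticks k)

/-- Procedure `f`, started on `d`, halts, its outputs are the elements of `S` (each one exactly
once), and every stretch of the run without output takes at most `T` units of time: the one before
the first output (the whole run, if there is none), those between two consecutive outputs, and
the one after the last output. -/
def EnumeratesWithDelay {F : Type} (code : F → Exp F) (f : F) (d : Data)
    (S : Set (List Data)) (T : ℕ) : Prop :=
  ∃ (v : Data) (t : Trace) (L : List (List Data)),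
    Run code f d v t ∧
    t.filterMap id = L.map Data.ofList ∧ L.Nodup ∧ (∀ a, a ∈ L ↔ a ∈ S) ∧
    ∀ t₁ t₂ t₃ : Trace, t = t₁ ++ t₂ ++ t₃ → (∀ o ∈ t₂, o = none) → t₂.length ≤ T

/-! ## Relational structures, homomorphisms, cores -/

/-- Names of variables, of values, and of ordinary relation symbols. -/
abbrev Name : Type := Data

/-- Relation symbols: ordinary ones, and for every variable `X` the distinguished unary domain
symbol `dom X`. -/
inductive Sym : Type
  | rel (n : Name) : Sym
  | dom (X : Name) : Sym
  deriving DecidableEq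

/-- A relational structure with relation symbols in `σ`: a universe and, for each symbol, a set of
tuples. -/
@[ext] structure Str (σ : Type) : Type where
  univ : Set Name
  rel : σ → Set (List Name)

namespace Str

variable {σ σ' : Type}

/-- `h` is a homomorphism from `A` to `B`. Only the values of `h` on the universe of `A` matter. -/
def IsHom (h : Name → Name) (A B : Str σ) : Prop :=
  (∀ x ∈ A.univ, h x ∈ B.univ) ∧ ∀ R, ∀ t ∈ A.rel R, t.map h ∈ B.rel R

/-- `A'` is a substructure of `A` (not necessarily an induced one). -/
def IsSubstructure (A' A : Str σ) : Prop :=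
  A'.univ ⊆ A.univ ∧ (∀ R, A'.rel R ⊆ A.rel R) ∧ ∀ R, ∀ t ∈ A'.rel R, ∀ x ∈ t, x ∈ A'.univ

/-- `A'` is a core of `A`: a substructure to which `A` maps homomorphically, and no proper
substructure of which has this property. -/
def IsCore (A' A : Str σ) : Prop :=
  A'.IsSubstructure A ∧ (∃ h, IsHom h A A') ∧
    ∀ A'' : Str σ, A''.IsSubstructure A' → (∃ h, IsHom h A A'') → A'' = A'

/-- The union of two structures with disjoint vocabularies. -/
def union (A : Str σ) (B : Str σ') : Str (σ ⊕ σ') where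
  univ := A.univ ∪ B.univ
  rel := Sum.elim A.rel B.rel

/-- The union, for `X` in `O`, of the structures with universe `{X}`, a fresh unary symbol (here
called `X`), and the single tuple `⟨X⟩`. -/
def singletons (O : List Name) : Str Name where
  univ := {X | X ∈ O}
  rel X := {t | X ∈ O ∧ t = [X]}

end Str

/-! ## Hypergraphs and tree projections -/

structure Hypergraph : Type where
  nodes : Set Name
  edges : Set (Set Name)
  edges_subset : ∀ e ∈ edges, e ⊆ nodes

namespace Hypergraph

/-- Each hyperedge of `H₁` is contained in a hyperedge of `H₂`. -/
def Le (H₁ H₂ : Hypergraph) : Prop := ∀ e ∈ H₁.edges, ∃ f ∈ H₂.edges, e ⊆ f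

/-- `T` is a join tree of `H`: a tree on the hyperedges such that a node that occurs in two
hyperedges occurs in every hyperedge on the path between them. The empty tree is allowed, for a
hypergraph without hyperedges. -/
def IsJoinTree (H : Hypergraph) (T : SimpleGraph H.edges) : Prop :=
  T.Preconnected ∧ T.IsAcyclic ∧
    ∀ (e f : H.edges) (X : Name), X ∈ e.1 → X ∈ f.1 →
      ∀ w : T.Walk e f, w.IsPath → ∀ g ∈ w.support, X ∈ g.1

def Acyclic (H : Hypergraph) : Prop := ∃ T, H.IsJoinTree T

/-- `(H₁, H₂)` has a tree projection. -/
def HasTreeProjection (H₁ H₂ : Hypergraph) : Prop :=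
  ∃ Ha : Hypergraph, Ha.Acyclic ∧ H₁.Le Ha ∧ Ha.Le H₂

end Hypergraph

/-- The hypergraph of a structure: one hyperedge for each tuple. (Entries of tuples are in the
universe in all structures that are considered; they are added to the nodes otherwise.) -/
def Str.hypergraph {σ : Type} (A : Str σ) : Hypergraph where
  nodes := A.univ ∪ {x | ∃ R, ∃ t ∈ A.rel R, x ∈ t}
  edges := {e | ∃ R, ∃ t ∈ A.rel R, e = {x | x ∈ t}}
  edges_subset := by
    rintro e ⟨R, t, ht, rfl⟩ x hx
    exact Or.inr ⟨R, t, ht, hx⟩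

/-! ## Finite structures as inputs, instances, views -/

/-- A finite relational structure, listed: its universe, and its relation symbols with their
relations. Repetitions and the order in the lists do not matter for the structure. -/
structure FinStr : Type where
  univ : List Name
  rels : List (Sym × List (List Name))

namespace FinStr

/-- The vocabulary. -/
def voc (A : FinStr) : List Sym := A.rels.map Prod.fst

/-- The relation of the symbol `R`. -/
def rel (A : FinStr) (R : Sym) : Set (List Name) := {t | ∃ p ∈ A.rels, p.1 = R ∧ t ∈ p.2}

/-- The structure that is listed. -/
def toStr (A : FinStr) : Str Sym where
  univ := {x | x ∈ A.univ}
  rel := A.rel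

/-- Each symbol is listed once and has an arity, and the relations are over the universe. -/
def WellFormed (A : FinStr) : Prop :=
  A.voc.Nodup ∧ (∀ R, ∃ k, ∀ t ∈ A.rel R, t.length = k) ∧
    ∀ R, ∀ t ∈ A.rel R, ∀ x ∈ t, x ∈ A.univ

/-- `A` is an `ℓ`-structure: the symbol `dom X`, if present, is interpreted by `{⟨X⟩}`. -/
def IsLeft (A : FinStr) : Prop :=
  A.WellFormed ∧ ∀ X, Sym.dom X ∈ A.voc → A.rel (.dom X) = {[X]}

/-- The `ℓ`-structure of the domain-restricted version of an instance with output variables `O`: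
a constraint `dom X` is added for each `X` in `O` that has none. It is `A` itself if all output
variables are domain restricted in `A`. -/
def domRestrict (A : FinStr) : List Name → FinStr
  | [] => A
  | X :: O =>
    if Sym.dom X ∈ A.voc then domRestrict A O
    else domRestrict ⟨A.univ, (Sym.dom X, [[X]]) :: A.rels⟩ O

end FinStr

/-- `(A, B)` is a CSP instance: structures over the same vocabulary, the universe of `B` not
empty. -/
def IsInstance (A B : FinStr) : Prop :=
  A.IsLeft ∧ B.WellFormed ∧ B.univ ≠ [] ∧ (∀ R, R ∈ A.voc ↔ R ∈ B.voc) ∧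
    ∀ R, ∃ k, (∀ t ∈ A.rel R, t.length = k) ∧ ∀ t ∈ B.rel R, t.length = k

/-- `A^B[O]`, the solutions of the ECSP instance `(A, B, O)`: the restrictions to `O` of the
homomorphisms from `A` to `B`, each one written as the tuple of its values on `O`. -/
def solutions (A B : FinStr) (O : List Name) : Set (List Name) :=
  {a | ∃ h, Str.IsHom h A.toStr B.toStr ∧ a = O.map h}

/-- A view of a `v`-structure: its tuple of variables, and the symbols `R` of the original
structure such that it is a base view of the constraint with this scope and relation symbol `R`. -/
structure View : Type where
  scope : List Name
  base : List Sym

/-- The list `V` of views is a `v`-structure for `A`; its symbols are the positions in the list. -/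
def IsViewStructure (A : FinStr) (V : List View) : Prop :=
  (∀ v ∈ V, ∀ x ∈ v.scope, x ∈ A.univ) ∧
  (∀ v ∈ V, ∀ R ∈ v.base, v.scope ∈ A.rel R) ∧
  ∀ R, ∀ t ∈ A.rel R, ∃ v ∈ V, v.scope = t ∧ R ∈ v.base

/-- The hypergraph of a `v`-structure. -/
def viewHypergraph (V : List View) : Hypergraph where
  nodes := {x | ∃ v ∈ V, x ∈ v.scope}
  edges := {e | ∃ v ∈ V, e = {x | x ∈ v.scope}}
  edges_subset := by
    rintro e ⟨v, hv, rfl⟩ x hx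
    exact ⟨v, hv, hx⟩

/-- The list `W` of relations (one for each view in `V`, in the same order) is an `r`-structure that
is legal with respect to `V` and `(A, B)`. -/
def IsLegal (A B : FinStr) (V : List View) (W : List (List (List Name))) : Prop :=
  V.length = W.length ∧
  ∀ p ∈ V.zip W,
    (∀ u ∈ p.2, u.length = p.1.scope.length) ∧
    (∀ u ∈ solutions A B p.1.scope, u ∈ p.2) ∧
    ∀ R ∈ p.1.base, ∀ u ∈ p.2, u ∈ B.rel R

/-- With `V` as the views: some core of `A ⊎ ⨄_{X ∈ O} S_{X}` has a tree projection with respect to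
the hypergraph of `V`. -/
def TpCovered (A : FinStr) (O : List Name) (V : List View) : Prop :=
  ∃ A' : Str (Sym ⊕ Name), A'.IsCore (A.toStr.union (Str.singletons O)) ∧
    A'.hypergraph.HasTreeProjection (viewHypergraph V)

/-! ## Encodings and decomposition methods -/

/-- A list, encoded. -/
def encList {α : Type} (f : α → Data) (l : List α) : Data := Data.ofList (l.map f)

def encSym : Sym → Data
  | .rel n => .cons .nil n
  | .dom X => .cons (.cons .nil .nil) X

/-- A relation, encoded as the list of its tuples. -/
def encRel (r : List (List Name)) : Data := encList Data.ofList r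

def FinStr.enc (A : FinStr) : Data :=
  .cons (Data.ofList A.univ) (encList (fun p => Data.cons (encSym p.1) (encRel p.2)) A.rels)

def View.enc (v : View) : Data := .cons (Data.ofList v.scope) (encList encSym v.base)

/-- A decomposition method: a function that computes a `v`-structure from an `ℓ`-structure, a
function that computes a legal `r`-structure from a CSP instance, and procedures that compute them
in polynomial time. -/
structure DecompositionMethod : Type 1 where
  left : FinStr → List View
  right : FinStr → FinStr → List (List (List Name))
  left_isViewStructure : ∀ A, A.IsLeft → IsViewStructure A (left A)
  right_isLegal : ∀ A B, IsInstance A B → IsLegal A B (left A) (right A B)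
  /-- names of procedures -/
  Proc : Type
  finite_proc : Finite Proc
  code : Proc → Exp Proc
  leftProc : Proc
  rightProc : Proc
  left_polynomial : ∃ p : Polynomial ℕ, ∀ A, A.IsLeft →
    ComputesWithin code leftProc A.enc (encList View.enc (left A)) (p.eval A.enc.size)
  right_polynomial : ∃ p : Polynomial ℕ, ∀ A B, IsInstance A B →
    ComputesWithin code rightProc (.cons A.enc B.enc) (encList encRel (right A B))
      (p.eval (Data.cons A.enc B.enc).size)

/-! ## The algorithm -/

/-- The procedures of the algorithm. -/
inductive Proc : Type
  | mem | snoc | lookup | hasSym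
  | findTuple | pick | project | unary | column | restrict
  | agreeAt | agree | supported | supportedAll | filterRel | revise | gac | allNonempty
  | zip | domRel | values | fixDom | propagate | forEach | computeAll

namespace Exp

variable {F : Type}

/-! Abbreviations for programs. `arg1`, ..., `arg5` unpack an argument `(x₁, (x₂, ...))` of a
procedure into the variables `1, 2, ...`; `caseL k e n c` and `letV k e b` bind the variables `k`
(and `k + 1`). -/

def arg1 (b : Exp F → Exp F) : Exp F := letE 1 (var 0) (b (var 1))

def arg2 (b : Exp F → Exp F → Exp F) : Exp F :=
  caseE (var 0) nil 1 2 (b (var 1) (var 2))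

def arg3 (b : Exp F → Exp F → Exp F → Exp F) : Exp F :=
  caseE (var 0) nil 1 2 (caseE (var 2) nil 2 3 (b (var 1) (var 2) (var 3)))

def arg4 (b : Exp F → Exp F → Exp F → Exp F → Exp F) : Exp F :=
  caseE (var 0) nil 1 2 (caseE (var 2) nil 2 3 (caseE (var 3) nil 3 4
    (b (var 1) (var 2) (var 3) (var 4))))

def arg5 (b : Exp F → Exp F → Exp F → Exp F → Exp F → Exp F) : Exp F :=
  caseE (var 0) nil 1 2 (caseE (var 2) nil 2 3 (caseE (var 3) nil 3 4 (caseE (var 4) nil 4 5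
    (b (var 1) (var 2) (var 3) (var 4) (var 5)))))

def caseL (k : ℕ) (e n : Exp F) (c : Exp F → Exp F → Exp F) : Exp F :=
  caseE e n k (k + 1) (c (var k) (var (k + 1)))

def letV (k : ℕ) (e : Exp F) (b : Exp F → Exp F) : Exp F := letE k e (b (var k))

/-- A value that is known to be a pair, unpacked. -/
def split (k : ℕ) (e : Exp F) (c : Exp F → Exp F → Exp F) : Exp F := caseL k e nil c

def true : Exp F := cons nil nil

def false : Exp F := nil

/-- The list with one element. -/
def single (e : Exp F) : Exp F := cons e nil

/-- The symbol `dom X`. -/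
def domSym (X : Exp F) : Exp F := cons (cons nil nil) X

def call2 (f : F) (a b : Exp F) : Exp F := call f (cons a b)

def call3 (f : F) (a b c : Exp F) : Exp F := call f (cons a (cons b c))

def call4 (f : F) (a b c d : Exp F) : Exp F := call f (cons a (cons b (cons c d)))

def call5 (f : F) (a b c d e : Exp F) : Exp F :=
  call f (cons a (cons b (cons c (cons d e))))

end Exp

section Algorithm

open Exp

/-- The bodies of the procedures of the algorithm, for a decomposition method with procedures `F`,
of which `l` computes the `v`-structure and `r` the `r`-structure. The pair of a `v`-structure and
an `r`-structure over it is kept as the list of the pairs `(v, r)` of a view `v = (s, b)`, with scope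
`s` and list of base symbols `b`, and of its relation `r`. -/
def algorithm {F : Type} (l r : F) : Proc → Exp (F ⊕ Proc)
  /- is `x` in the list `xs`? -/
  | .mem => arg2 fun x xs =>
      caseL 10 xs false fun y ys => ite (eq x y) true (call2 (.inr .mem) x ys)
  /- the list `xs` with `x` added at the end -/
  | .snoc => arg2 fun xs x =>
      caseL 10 xs (single x) fun y ys => cons y (call2 (.inr .snoc) ys x)
  /- the relation of the symbol `R` -/
  | .lookup => arg2 fun R rels =>
      caseL 10 rels nil fun e rest => split 20 e fun R' ts =>
        ite (eq R R') ts (call2 (.inr .lookup) R rest)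
  /- is the symbol `R` in the vocabulary? -/
  | .hasSym => arg2 fun R rels =>
      caseL 10 rels false fun e rest => split 20 e fun R' _ =>
        ite (eq R R') true (call2 (.inr .hasSym) R rest)
  /- the first tuple in `ts` in which `X` occurs; `nil` if there is none -/
  | .findTuple => arg2 fun X ts =>
      caseL 10 ts nil fun t rest =>
        ite (call2 (.inr .mem) X t) t (call2 (.inr .findTuple) X rest)
  /- the entry of the tuple `u` where `X` first occurs in the scope `t` -/
  | .pick => arg3 fun X t u =>
      caseL 10 t nil fun y ys => caseL 20 u nil fun a as =>
        ite (eq X y) a (call3 (.inr .pick) X ys as)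
  /- the column of the relation `us` where `X` first occurs in the scope `t` -/
  | .project => arg3 fun X t us =>
      caseL 10 us nil fun u rest =>
        cons (single (call3 (.inr .pick) X t u)) (call3 (.inr .project) X t rest)
  /- the unary relation with the elements of the list `xs` -/
  | .unary => arg1 fun xs =>
      caseL 10 xs nil fun x rest => cons (single x) (call (.inr .unary) rest)
  /- the domain for a variable `X`: the values of `X` in the relation of the first constraint of
  the left structure (with relations `rels`) in which `X` occurs; all values if there is none -/
  | .column => arg3 fun X rels B =>
      caseL 10 rels (split 20 B fun ub _ => call (.inr .unary) ub) fun e rest =>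
        split 20 e fun R ts => letV 30 (call2 (.inr .findTuple) X ts) fun t =>
          caseL 40 t (call3 (.inr .column) X rest B) fun _ _ =>
            split 50 B fun _ rb => call3 (.inr .project) X t (call2 (.inr .lookup) R rb)
  /- the pair of structures of the domain-restricted version of `(A, B, O)` -/
  | .restrict => arg3 fun O A B =>
      caseL 10 O (cons A B) fun X O' => split 20 A fun ua ra => split 30 B fun ub rb =>
        ite (call2 (.inr .hasSym) (domSym X) ra)
          (call3 (.inr .restrict) O' A B)
          (call3 (.inr .restrict) O'
            (cons ua (cons (cons (domSym X) (single (single X))) ra))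
            (cons ub (cons (cons (domSym X) (call3 (.inr .column) X ra B)) rb)))
  /- does `u' j = a` hold for all `j` with `s' j = x`? -/
  | .agreeAt => arg4 fun x a s' u' =>
      caseL 10 s' true fun y ys => caseL 20 u' true fun b bs =>
        ite (eq x y) (ite (eq a b) (call4 (.inr .agreeAt) x a ys bs) false)
          (call4 (.inr .agreeAt) x a ys bs)
  /- does `u i = u' j` hold for all `i, j` with `s i = s' j`? -/
  | .agree => arg4 fun s u s' u' =>
      caseL 10 s true fun x xs => caseL 20 u true fun a as =>
        ite (call4 (.inr .agreeAt) x a s' u') (call4 (.inr .agree) xs as s' u') false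
  /- does the tuple `u` over `s` agree, on the common variables, with some tuple over `s'` in the
  relation `us`? -/
  | .supported => arg4 fun s u s' us =>
      caseL 10 us false fun u' rest =>
        ite (call4 (.inr .agree) s u s' u') true (call4 (.inr .supported) s u s' rest)
  /- the same, for all views in `V` -/
  | .supportedAll => arg3 fun s u V =>
      caseL 10 V true fun w rest => split 20 w fun v us => split 30 v fun s' _ =>
        ite (call4 (.inr .supported) s u s' us) (call3 (.inr .supportedAll) s u rest) false
  /- the tuples over `s` in the relation `us` that are supported in all views -/
  | .filterRel => arg3 fun s us V =>
      caseL 10 us nil fun u rest => letV 20 (call3 (.inr .filterRel) s rest V) fun k =>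
        ite (call3 (.inr .supportedAll) s u V) (cons u k) k
  /- one round of filtering all the relations in `W` -/
  | .revise => arg2 fun W V =>
      caseL 10 W nil fun w rest => split 20 w fun v us => split 30 v fun s _ =>
        cons (cons v (call3 (.inr .filterRel) s us V)) (call2 (.inr .revise) rest V)
  /- generalized arc consistency: filter until nothing changes -/
  | .gac => arg1 fun V =>
      letV 10 (call2 (.inr .revise) V V) fun V' => ite (eq V' V) V (call (.inr .gac) V')
  /- are all the relations nonempty? -/
  | .allNonempty => arg1 fun V =>
      caseL 10 V true fun w rest => split 20 w fun _ us =>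
        caseL 30 us false fun _ _ => call (.inr .allNonempty) rest
  /- the views with their relations -/
  | .zip => arg2 fun V W =>
      caseL 10 V nil fun v vs => caseL 20 W nil fun us rest =>
        cons (cons v us) (call2 (.inr .zip) vs rest)
  /- the relation of the base view for the symbol `d` -/
  | .domRel => arg2 fun d V =>
      caseL 10 V nil fun w rest => split 20 w fun v us => split 30 v fun _ b =>
        ite (call2 (.inr .mem) d b) us (call2 (.inr .domRel) d rest)
  /- the elements of a unary relation, without repetitions -/
  | .values => arg1 fun us =>
      caseL 10 us nil fun u rest => letV 20 (call (.inr .values) rest) fun k =>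
        split 30 u fun a _ => ite (call2 (.inr .mem) a k) k (cons a k)
  /- the relation of the base view for the symbol `d` is updated with `{⟨a⟩}` -/
  | .fixDom => arg3 fun d a V =>
      caseL 10 V nil fun w rest => split 20 w fun v _ => split 30 v fun _ b =>
        ite (call2 (.inr .mem) d b) (cons (cons v (single (single a))) rest)
          (cons w (call3 (.inr .fixDom) d a rest))
  /- `O`: the variables that are not yet fixed; `p`: the values of the others. If the set of output
  variables is empty, the empty tuple is output, provided that the consistent views are nonempty. -/
  | .propagate => arg3 fun O V p =>
      letV 10 (call (.inr .gac) V) fun V' =>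
        caseL 20 O (ite (call (.inr .allNonempty) V') (emit p) nil) fun X O' =>
          call5 (.inr .forEach)
            (call (.inr .values) (call2 (.inr .domRel) (domSym X) V')) X O' V' p
  /- for each value `a` in `as`: fix `X` to `a` and go on with the remaining variables `O'` -/
  | .forEach => arg5 fun as X O' V p =>
      caseL 10 as nil fun a rest => letV 20 (call2 (.inr .snoc) p a) fun p' =>
        letV 30
          (caseL 40 O' (emit p') fun _ _ =>
            call3 (.inr .propagate) O' (call3 (.inr .fixDom) (domSym X) a V) p')
          fun _ => call5 (.inr .forEach) rest X O' V p
  /- the input is an instance `(A, B, O)` -/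
  | .computeAll => arg3 fun A B O =>
      letV 10 (call3 (.inr .restrict) O A B) fun AB => split 20 AB fun A₀ _ =>
        call3 (.inr .propagate) O
          (call2 (.inr .zip) (call (.inl l) A₀) (call (.inl r) AB)) nil

end Algorithm

/-- The program `ComputeAllSolutions_DM`: the procedures of the decomposition method together with
those of the algorithm. -/
def computeAllSolutions (dm : DecompositionMethod) : dm.Proc ⊕ Proc → Exp (dm.Proc ⊕ Proc)
  | .inl f => (dm.code f).map Sum.inl
  | .inr f => algorithm dm.leftProc dm.rightProc f

/-- An ECSP instance `(A, B, O)`, encoded. -/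
def encInstance (A B : FinStr) (O : List Name) : Data :=
  .cons A.enc (.cons B.enc (Data.ofList O))

end ECSP

namespace ECSP

/-! ## Sizes and encodings -/

namespace Data

/-! Correctness and delay both rest on one fact: once generalized arc consistency is enforced, the
values left for the next output variable are exactly its values in the solutions that extend the
values already fixed (`IsState.exists_values`). Hence every value that is tried leads to an output,
and the search has no dead ends.

No solution is lost: adding domain constraints leaves the homomorphisms unchanged (`isHom_addDom`),
a legal family contains the restriction of each homomorphism to each view, and these restrictions
support each other, so that revision never deletes them (`Carries.revise`).

Conversely, let `C` be the core and `H` the hypergraph of the tree projection. Each hyperedge of `H`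
lies in the scope of a view. Start at a hyperedge that contains `X`, with a tuple of its view that
has the value `a` at `X`, and move outwards in the join tree. Consistency extends the choice at each
step, and the join tree condition makes all choices agree, so that they form one function `h`
(`exists_glue`). A tuple of `C` is contained in a hyperedge of `H`, so by consistency `h` maps it
into the relation of its base view, hence into the relation of `B`. Therefore `h` is a homomorphism
on `C`; composed with the map of `A` to `C`, which fixes the output variables because of their
private unary symbols, it is a solution with the value `a` at `X` (`exists_hom_of_isConsistent`). It
also respects the values fixed before, as `[Y]` is a tuple of `C` for every output variable `Y` and
so `h Y` lies in every view with scope `[Y]`.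

For the time, each silent procedure is a list recursion nested to bounded depth, with cost at most
`cst k N`; arc consistency needs at most one productive round per tuple of the views. Fixing a value
does not enlarge the family (`size_fixRel_le_of_mem`), so one polynomial bound `H` serves all levels
of the recursion. Between two outputs the run climbs and descends at most `|O|` levels, each at a
cost of a few `H`. The predicate `Enumerates` records how much silent time a run needs before its
first and after its last output, so that these costs add up to a delay linear in `|O| * H`. If there
is no solution, the first list of values is already empty. -/

@[simp] theorem size_nil : size nil = 1 := rfl

@[simp] theorem size_cons (a b : Data) : size (cons a b) = 1 + size a + size b := rfl

theorem size_pos (d : Data) : 0 < d.size := by cases d <;> simp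

/-- Case distinction on a tree. -/
def elim {α : Sort*} (d : Data) (n : α) (c : Data → Data → α) : α :=
  match d with
  | nil => n
  | cons a b => c a b

@[simp] theorem elim_nil {α : Sort*} (n : α) (c : Data → Data → α) : elim nil n c = n := rfl

@[simp] theorem elim_cons {α : Sort*} (a b : Data) (n : α) (c : Data → Data → α) :
    elim (cons a b) n c = c a b := rfl

@[simp] theorem ofList_nil : ofList [] = nil := rfl

@[simp] theorem ofList_cons (a : Data) (l : List Data) : ofList (a :: l) = cons a (ofList l) := rfl

theorem ofList_injective : Function.Injective ofList := by
  intro l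
  induction l with
  | nil => intro l' h; cases l' <;> simp_all
  | cons a l ih =>
    intro l' h
    cases l' with
    | nil => simp at h
    | cons b l' =>
      simp only [ofList_cons, cons.injEq] at h
      rw [h.1, ih h.2]

theorem length_lt_size (l : List Data) : l.length < (ofList l).size := by
  induction l with
  | nil => simp
  | cons a l ih => simp; omega

theorem size_lt_of_mem {a : Data} {l : List Data} (h : a ∈ l) : a.size + 1 < (ofList l).size := by
  induction l with
  | nil => simp at h
  | cons b l ih =>
    have h₁ := size_pos b
    have h₂ := size_pos (ofList l)
    rcases List.mem_cons.1 h with rfl | h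
    · simp; omega
    · have := ih h
      simp; omega

theorem size_ofList_append (l l' : List Data) :
    (ofList (l ++ l')).size + 1 = (ofList l).size + (ofList l').size := by
  induction l with
  | nil => simp; omega
  | cons a l ih => simp; omega

theorem size_ofList_le_of_sublist {l l' : List Data} (h : l.Sublist l') :
    (ofList l).size ≤ (ofList l').size := by
  induction h with
  | slnil => simp
  | cons a _ ih => simp; omega
  | cons_cons a _ ih => simp; omega

/-- The truth value of a proposition. -/
def ofProp (p : Prop) [Decidable p] : Data := if p then tt else nil

@[simp] theorem ofProp_true : ofProp True = cons nil nil := rfl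

@[simp] theorem ofProp_false : ofProp False = nil := rfl

theorem ofProp_pos {p : Prop} [Decidable p] (h : p) : ofProp p = cons nil nil := if_pos h

theorem ofProp_neg {p : Prop} [Decidable p] (h : ¬p) : ofProp p = nil := if_neg h

theorem ofProp_congr {p q : Prop} [Decidable p] [Decidable q] (h : p ↔ q) :
    ofProp p = ofProp q := by
  unfold ofProp; simp only [h]

end Data

@[simp] theorem encList_nil {α : Type} (f : α → Data) : encList f [] = Data.nil := rfl

@[simp] theorem encList_cons {α : Type} (f : α → Data) (a : α) (l : List α) :
    encList f (a :: l) = Data.cons (f a) (encList f l) := rfl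

theorem encList_injective {α : Type} {f : α → Data} (hf : Function.Injective f) :
    Function.Injective (encList f) :=
  Data.ofList_injective.comp (List.map_injective_iff.2 hf)

theorem encSym_injective : Function.Injective encSym := by
  intro R R' h
  cases R <;> cases R' <;> simp_all [encSym]

theorem encRel_injective : Function.Injective encRel := encList_injective Data.ofList_injective

@[simp] theorem encRel_nil : encRel [] = Data.nil := rfl

@[simp] theorem encRel_cons (u : List Name) (r : List (List Name)) :
    encRel (u :: r) = Data.cons (Data.ofList u) (encRel r) := rfl

theorem size_encRel_map_singleton_le (xs : List Name) :
    (encRel (xs.map ([·]))).size ≤ 3 * (Data.ofList xs).size := by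
  induction xs with
  | nil => simp
  | cons x xs ih => simp; omega

theorem View.enc_injective : Function.Injective View.enc := by
  rintro ⟨s, b⟩ ⟨s', b'⟩ h
  simp only [View.enc, Data.cons.injEq] at h
  rw [Data.ofList_injective h.1, encList_injective encSym_injective h.2]

/-- A view together with its relation. -/
abbrev Table : Type := View × List (List Name)

def Table.enc (w : Table) : Data := .cons w.1.enc (encRel w.2)

theorem Table.enc_injective : Function.Injective Table.enc := by
  rintro ⟨v, r⟩ ⟨v', r'⟩ h
  simp only [Table.enc, Data.cons.injEq] at h
  rw [View.enc_injective h.1, encRel_injective h.2]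

/-- A listed relation with its symbol, encoded. -/
def encEntry (p : Sym × List (List Name)) : Data := .cons (encSym p.1) (encRel p.2)

theorem FinStr.enc_eq (A : FinStr) :
    A.enc = .cons (Data.ofList A.univ) (encList encEntry A.rels) := rfl

theorem length_lt_size_encList {α : Type} (f : α → Data) (l : List α) :
    l.length < (encList f l).size := by
  simpa [encList] using Data.length_lt_size (l.map f)

theorem size_lt_of_mem_encList {α : Type} (f : α → Data) {a : α} {l : List α} (h : a ∈ l) :
    (f a).size + 1 < (encList f l).size :=
  Data.size_lt_of_mem (List.mem_map_of_mem h)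

theorem size_encList_le_of_sublist {α : Type} (f : α → Data) {l l' : List α}
    (h : l.Sublist l') : (encList f l).size ≤ (encList f l').size :=
  Data.size_ofList_le_of_sublist (h.map f)

/-! ## Runs of programs -/

@[simp] theorem length_ticks (k : ℕ) : (ticks k).length = k := List.length_replicate

theorem ticks_append (k m : ℕ) : ticks k ++ ticks m = ticks (k + m) := by
  simp [ticks, List.replicate_append_replicate]

/-- Building a value takes at least as many steps as it has nodes. -/
theorem Eval.size_le {F : Type} {code : F → Exp F} {env : ℕ → Data} {e : Exp F} {v : Data}
    {t : Trace} (h : Eval code env e v t) : v.size ≤ t.length := by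
  induction h with
  -- The value `tt` has three nodes: two are paid for by the operands, of at least one node each,
  -- and one by the test itself.
  | @eq _ _ _ u v _ _ _ _ ih₁ ih₂ =>
    have h₁ := u.size_pos
    have h₂ := v.size_pos
    split_ifs <;> simp [Data.tt] <;> omega
  | _ => simp_all <;> omega

/-- The procedures of the decomposition method occur in the whole program as renamed copies; their
runs carry over with the same history. -/
theorem Eval.map {F G : Type} {code : F → Exp F} {code' : G → Exp G} (g : F → G)
    (hg : ∀ f, code' (g f) = (code f).map g) {env : ℕ → Data} {e : Exp F} {v : Data} {t : Trace}
    (h : Eval code env e v t) : Eval code' env (e.map g) v t := by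
  induction h with
  | var => exact .var _ _
  | nil => exact .nil _
  | cons _ _ ih₁ ih₂ => exact .cons ih₁ ih₂
  | eq _ _ ih₁ ih₂ => exact .eq ih₁ ih₂
  | ite_false _ _ ih₁ ih₂ => exact .ite_false ih₁ ih₂
  | ite_true _ _ ih₁ ih₂ => exact .ite_true ih₁ ih₂
  | letE _ _ ih₁ ih₂ => exact .letE ih₁ ih₂
  | case_nil _ _ ih₁ ih₂ => exact .case_nil ih₁ ih₂
  | case_cons _ _ ih₁ ih₂ => exact .case_cons ih₁ ih₂
  | call _ _ ih₁ ih₂ => exact .call ih₁ (by rw [hg]; exact ih₂)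
  | emit _ ih => exact .emit ih

namespace ComputesWithin

variable {F : Type} {code : F → Exp F} {f : F} {d v : Data} {T : ℕ}

theorem mono {T' : ℕ} (h : ComputesWithin code f d v T) (hT : T ≤ T') :
    ComputesWithin code f d v T' := by
  obtain ⟨k, hk, h⟩ := h
  exact ⟨k, hk.trans hT, h⟩

/-- Time bounds size: this turns the polynomial time of the decomposition method into a polynomial
bound on its views and relations. -/
theorem size_le (h : ComputesWithin code f d v T) : v.size ≤ T := by
  obtain ⟨k, hk, h⟩ := h
  simpa using (Eval.size_le h).trans (by simpa using hk)

theorem map {G : Type} {code' : G → Exp G} (g : F → G) (hg : ∀ f, code' (g f) = (code f).map g)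
    (h : ComputesWithin code f d v T) : ComputesWithin code' (g f) d v T := by
  obtain ⟨k, hk, h⟩ := h
  refine ⟨k, hk, ?_⟩
  unfold Run at h ⊢
  rw [hg]
  exact h.map g hg

end ComputesWithin

/-- The weakest precondition for a silent evaluation of `e` to a value `v` within `n` units of time
such that `Q v n`. -/
def silent {F : Type} (code : F → Exp F) : (ℕ → Data) → Exp F → (Data → ℕ → Prop) → Prop
  | env, .var x, Q => Q (env x) (env x).size
  | _, .nil, Q => Q .nil 1
  | env, .cons a b, Q => silent code env a fun u m => silent code env b fun v n =>
      Q (.cons u v) (m + n + (1 + u.size + v.size))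
  | env, .eq a b, Q => silent code env a fun u m => silent code env b fun v n =>
      Q (Data.ofProp (u = v)) (m + n + 1)
  | env, .ite c a b, Q => silent code env c fun u m =>
      u.elim (silent code env b fun v n => Q v (m + 1 + n))
        fun _ _ => silent code env a fun v n => Q v (m + 1 + n)
  | env, .letE x e b, Q => silent code env e fun u m =>
      silent code (Function.update env x u) b fun v n => Q v (m + 1 + n)
  | env, .caseE e n x y c, Q => silent code env e fun u m =>
      u.elim (silent code env n fun v n => Q v (m + 1 + n))
        fun a b => silent code (Function.update (Function.update env x a) y b) c
          fun v n => Q v (m + 1 + n)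
  | env, .call f e, Q => silent code env e fun u m =>
      ∃ v T, ComputesWithin code f u v T ∧ Q v (m + 1 + T)
  | _, .emit _, _ => False

attribute [simp] silent Exp.arg1 Exp.arg2 Exp.arg3 Exp.arg4 Exp.arg5 Exp.caseL Exp.letV Exp.split
  Exp.true Exp.false Exp.single Exp.domSym Exp.call2 Exp.call3 Exp.call4 Exp.call5
  computeAllSolutions algorithm

theorem exists_eval_of_silent {F : Type} {code : F → Exp F} {env : ℕ → Data} {e : Exp F}
    {Q : Data → ℕ → Prop} (h : silent code env e Q) :
    ∃ v k n, Eval code env e v (ticks k) ∧ k ≤ n ∧ Q v n := by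
  induction e generalizing env Q with
  | var x => exact ⟨_, _, _, .var _ _, le_rfl, h⟩
  | nil => exact ⟨_, _, _, .nil _, le_rfl, h⟩
  | cons a b iha ihb =>
    obtain ⟨u, k, m, hu, hk, h⟩ := iha h
    obtain ⟨v, k', n, hv, hk', h⟩ := ihb h
    exact ⟨_, _, _, by simpa only [ticks_append] using hu.cons hv, by simp; omega, h⟩
  | eq a b iha ihb =>
    obtain ⟨u, k, m, hu, hk, h⟩ := iha h
    obtain ⟨v, k', n, hv, hk', h⟩ := ihb h
    exact ⟨_, _, _, by simpa only [ticks_append, Data.ofProp] using hu.eq hv, by omega, h⟩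
  | ite c a b ihc iha ihb =>
    obtain ⟨u, k, m, hu, hk, h⟩ := ihc h
    cases u with
    | nil =>
      obtain ⟨v, k', n, hv, hk', h⟩ := ihb h
      exact ⟨_, _, _, by simpa only [ticks_append] using hu.ite_false hv, by omega, h⟩
    | cons =>
      obtain ⟨v, k', n, hv, hk', h⟩ := iha h
      exact ⟨_, _, _, by simpa only [ticks_append] using hu.ite_true hv, by omega, h⟩
  | letE x e b ihe ihb =>
    obtain ⟨u, k, m, hu, hk, h⟩ := ihe h
    obtain ⟨v, k', n, hv, hk', h⟩ := ihb h
    exact ⟨_, _, _, by simpa only [ticks_append] using hu.letE hv, by omega, h⟩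
  | caseE e n x y c ihe ihn ihc =>
    obtain ⟨u, k, m, hu, hk, h⟩ := ihe h
    cases u with
    | nil =>
      obtain ⟨v, k', n, hv, hk', h⟩ := ihn h
      exact ⟨_, _, _, by simpa only [ticks_append] using hu.case_nil hv, by omega, h⟩
    | cons =>
      obtain ⟨v, k', n, hv, hk', h⟩ := ihc h
      exact ⟨_, _, _, by simpa only [ticks_append] using hu.case_cons hv, by omega, h⟩
  | call f e ihe =>
    obtain ⟨u, k, m, hu, hk, v, T, ⟨k', hk', hv⟩, h⟩ := ihe h
    exact ⟨_, _, _, by simpa only [ticks_append] using hu.call hv, by omega, h⟩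
  | emit e => exact h.elim

/-- All running times below are derived from this: unfolding `silent` on a procedure body leaves one
existential goal for each call, filled by an earlier bound or the induction hypothesis, and one
linear inequality. -/
theorem computesWithin_of_silent {F : Type} {code : F → Exp F} {f : F} {d v : Data} {T : ℕ}
    (h : silent code (Function.update (fun _ => Data.nil) 0 d) (code f)
      fun u n => u = v ∧ n ≤ T) : ComputesWithin code f d v T := by
  obtain ⟨_, k, n, h', hk, rfl, hn⟩ := exists_eval_of_silent h
  exact ⟨k, hk.trans hn, h'⟩

/-! ## Running times of the procedures without output -/

/-- A bound for the running time of a procedure with `k` nested levels of list recursion on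
arguments of size less than `N`. -/
def cst : ℕ → ℕ → ℕ
  | 0, _ => 0
  | k + 1, N => (N + 1) * (60 * (N + 1) + 3 * cst k N)

/-- The part of `cst (k + 1) N` for a list of length `n`. -/
def cstIter (k N n : ℕ) : ℕ := (n + 1) * (60 * (N + 1) + 3 * cst k N)

@[simp] theorem cstIter_zero (k N : ℕ) : cstIter k N 0 = 60 * (N + 1) + 3 * cst k N := by
  simp [cstIter]

@[simp] theorem cstIter_succ (k N n : ℕ) :
    cstIter k N (n + 1) = cstIter k N n + (60 * (N + 1) + 3 * cst k N) := by
  simp only [cstIter]; ring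

/-- Calls of procedures at a lower level are charged to a higher one. The factor `3` in `cst` leaves
room for the calls made in one iteration besides the recursive one, and `60 * (N + 1)` for the basic
steps and for copying data. -/
theorem cst_le_succ (k N : ℕ) : 3 * cst k N + 60 * (N + 1) ≤ cst (k + 1) N := by
  simp only [cst]
  nlinarith [Nat.zero_le (N * (60 * (N + 1) + 3 * cst k N))]

section

variable (dm : DecompositionMethod)

/-- Inductions run on the list with the bound `cstIter`, which grows by the cost of one iteration
per element; only at the end is the length replaced by `N`. -/
theorem ComputesWithin.of_cstIter {F : Type} {code : F → Exp F} {f : F} {d v : Data}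
    {k N : ℕ} (n : ℕ) (hn : n ≤ N) (h : ComputesWithin code f d v (cstIter k N n)) :
    ComputesWithin code f d v (cst (k + 1) N) :=
  h.mono (Nat.mul_le_mul_right _ (by omega))

theorem computes_mem {N : ℕ} (x : Data) (xs : List Data) (h : x.size + (Data.ofList xs).size < N) :
    ComputesWithin (computeAllSolutions dm) (.inr .mem) (.cons x (Data.ofList xs))
      (Data.ofProp (x ∈ xs)) (cst 1 N) := by
  refine .of_cstIter xs.length (by have := Data.length_lt_size xs; omega) ?_
  induction xs with
  | nil =>
    apply computesWithin_of_silent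
    simp at h ⊢
    omega
  | cons y ys ih =>
    simp at h
    apply computesWithin_of_silent
    by_cases hxy : x = y
    · simp [hxy] at h ⊢
      omega
    · simp [hxy, Data.ofProp_neg]
      exact ⟨_, ih (by omega), by omega⟩

theorem computes_snoc {N : ℕ} (xs : List Data) (x : Data) (h : (Data.ofList xs).size + x.size < N) :
    ComputesWithin (computeAllSolutions dm) (.inr .snoc) (.cons (Data.ofList xs) x)
      (Data.ofList (xs ++ [x])) (cst 1 N) := by
  refine .of_cstIter xs.length (by have := Data.length_lt_size xs; omega) ?_
  induction xs with
  | nil =>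
    apply computesWithin_of_silent
    simp at h ⊢
    omega
  | cons y ys ih =>
    simp at h
    apply computesWithin_of_silent
    have := Data.size_ofList_append ys [x]
    simp at this ⊢
    exact ⟨_, ih (by omega), by omega⟩

/-- The relation that is listed with the symbol `R`. -/
def lookupRel (R : Sym) : List (Sym × List (List Name)) → List (List Name)
  | [] => []
  | e :: rest => if R = e.1 then e.2 else lookupRel R rest

theorem computes_lookup {N : ℕ} (R : Sym) (rels : List (Sym × List (List Name)))
    (h : (encSym R).size + (encList encEntry rels).size < N) :
    ComputesWithin (computeAllSolutions dm) (.inr .lookup)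
      (.cons (encSym R) (encList encEntry rels)) (encRel (lookupRel R rels)) (cst 1 N) := by
  refine .of_cstIter rels.length (by have := length_lt_size_encList encEntry rels; omega) ?_
  induction rels with
  | nil =>
    apply computesWithin_of_silent
    simp [lookupRel] at h ⊢
    omega
  | cons e rest ih =>
    simp [encEntry] at h
    apply computesWithin_of_silent
    by_cases hR : R = e.1
    · simp [encEntry, lookupRel, hR] at h ⊢
      omega
    · simp [encEntry, lookupRel, hR, encSym_injective.eq_iff, Data.ofProp_neg]
      exact ⟨_, ih (by omega), by omega⟩

theorem computes_hasSym {N : ℕ} (R : Sym) (rels : List (Sym × List (List Name)))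
    (h : (encSym R).size + (encList encEntry rels).size < N) :
    ComputesWithin (computeAllSolutions dm) (.inr .hasSym)
      (.cons (encSym R) (encList encEntry rels)) (Data.ofProp (R ∈ rels.map Prod.fst))
      (cst 1 N) := by
  refine .of_cstIter rels.length (by have := length_lt_size_encList encEntry rels; omega) ?_
  induction rels with
  | nil =>
    apply computesWithin_of_silent
    simp at h ⊢
    omega
  | cons e rest ih =>
    simp [encEntry] at h
    apply computesWithin_of_silent
    by_cases hR : R = e.1
    · simp [encEntry, hR] at h ⊢
      omega
    · simp only [List.map_cons, List.mem_cons, hR, false_or]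
      simp [encEntry, hR, encSym_injective.eq_iff, Data.ofProp_neg, -List.mem_map]
      exact ⟨_, ih (by omega), by omega⟩

/-- The first tuple in which `X` occurs, or `[]`. -/
def findTuple (X : Name) : List (List Name) → List Name
  | [] => []
  | t :: rest => if X ∈ t then t else findTuple X rest

theorem computes_findTuple {N : ℕ} (X : Name) (ts : List (List Name))
    (h : X.size + (encRel ts).size < N) :
    ComputesWithin (computeAllSolutions dm) (.inr .findTuple)
      (.cons X (encRel ts)) (Data.ofList (findTuple X ts)) (cst 2 N) := by
  refine .of_cstIter ts.length
    (by have := length_lt_size_encList Data.ofList ts; simp only [encRel] at h; omega) ?_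
  induction ts with
  | nil =>
    apply computesWithin_of_silent
    simp [findTuple] at h ⊢
    omega
  | cons t rest ih =>
    simp at h
    apply computesWithin_of_silent
    simp
    refine ⟨_, _, computes_mem dm (N := N) X t (by omega), ?_⟩
    by_cases hX : X ∈ t
    · simp [findTuple, hX]
      omega
    · simp [findTuple, hX]
      exact ⟨_, ih (by omega), by omega⟩

/-- The entry of the tuple `u` at the first position of `X` in the scope. -/
def pickAt (X : Name) : List Name → List Name → Name
  | y :: ys, a :: as => if X = y then a else pickAt X ys as
  | _, _ => Data.nil

theorem computes_pick {N : ℕ} (X : Name) (t u : List Name)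
    (h : X.size + (Data.ofList t).size + (Data.ofList u).size < N) :
    ComputesWithin (computeAllSolutions dm) (.inr .pick)
      (.cons X (.cons (Data.ofList t) (Data.ofList u))) (pickAt X t u) (cst 1 N) := by
  refine .of_cstIter t.length (by have := Data.length_lt_size t; omega) ?_
  induction t generalizing u with
  | nil =>
    apply computesWithin_of_silent
    simp [pickAt] at h ⊢
    omega
  | cons y ys ih =>
    apply computesWithin_of_silent
    cases u with
    | nil =>
      simp [pickAt] at h ⊢
      omega
    | cons a as =>
      simp at h
      by_cases hX : X = y
      · simp [pickAt, hX] at h ⊢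
        omega
      · simp [pickAt, hX, Data.ofProp_neg]
        exact ⟨_, ih as (by omega), by omega⟩

theorem computes_unary {N : ℕ} (xs : List Name) (h : (Data.ofList xs).size < N) :
    ComputesWithin (computeAllSolutions dm) (.inr .unary)
      (Data.ofList xs) (encRel (xs.map ([·]))) (cst 1 N) := by
  refine .of_cstIter xs.length (by have := Data.length_lt_size xs; omega) ?_
  induction xs with
  | nil =>
    apply computesWithin_of_silent
    simp at h ⊢
    omega
  | cons x xs ih =>
    have := size_encRel_map_singleton_le xs
    simp at h
    apply computesWithin_of_silent
    simp
    exact ⟨_, ih (by omega), by omega⟩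

end

section

variable (dm : DecompositionMethod)

theorem size_pickAt_le (X : Name) (t u : List Name) :
    (pickAt X t u).size ≤ (Data.ofList u).size := by
  induction t generalizing u with
  | nil => simpa [pickAt] using Nat.succ_le_of_lt (Data.size_pos _)
  | cons y ys ih =>
    cases u with
    | nil => simp [pickAt]
    | cons a as =>
      have := ih as
      simp only [pickAt]
      split_ifs <;> simp <;> omega

theorem size_encRel_map_pickAt_le (X : Name) (t : List Name) (us : List (List Name)) :
    (encRel (us.map fun u => [pickAt X t u])).size ≤ 3 * (encRel us).size := by
  induction us with
  | nil => simp
  | cons u us ih =>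
    have := size_pickAt_le X t u
    simp
    omega

theorem computes_project {N : ℕ} (X : Name) (t : List Name) (us : List (List Name))
    (h : X.size + (Data.ofList t).size + (encRel us).size < N) :
    ComputesWithin (computeAllSolutions dm) (.inr .project)
      (.cons X (.cons (Data.ofList t) (encRel us))) (encRel (us.map fun u => [pickAt X t u]))
      (cst 2 N) := by
  refine .of_cstIter us.length
    (by have := length_lt_size_encList Data.ofList us; simp only [encRel] at h; omega) ?_
  induction us with
  | nil =>
    apply computesWithin_of_silent
    simp at h ⊢
    omega
  | cons u rest ih =>
    have h₁ := size_encRel_map_pickAt_le X t rest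
    have h₂ := size_pickAt_le X t u
    simp at h
    apply computesWithin_of_silent
    simp
    exact ⟨_, computes_pick dm (N := N) X t u (by omega), _, ih (by omega), by omega⟩

/-- The values of `X` in the relation of the first of the constraints `rels` in which `X` occurs;
all values if there is none. -/
def columnRel (X : Name) (B : FinStr) : List (Sym × List (List Name)) → List (List Name)
  | [] => B.univ.map ([·])
  | e :: rest =>
    if findTuple X e.2 = [] then columnRel X B rest
    else (lookupRel e.1 B.rels).map fun u => [pickAt X (findTuple X e.2) u]

theorem size_findTuple_le (X : Name) (ts : List (List Name)) :
    (Data.ofList (findTuple X ts)).size ≤ (encRel ts).size := by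
  induction ts with
  | nil => simp [findTuple]
  | cons t ts ih =>
    simp only [findTuple]
    split_ifs <;> simp <;> omega

theorem size_lookupRel_le (R : Sym) (rels : List (Sym × List (List Name))) :
    (encRel (lookupRel R rels)).size ≤ (encList encEntry rels).size := by
  induction rels with
  | nil => simp [lookupRel]
  | cons e rels ih =>
    simp only [lookupRel]
    split_ifs <;> simp [encEntry] <;> omega

theorem computes_column {N : ℕ} (X : Name) (rels : List (Sym × List (List Name))) (B : FinStr)
    (h : X.size + (encList encEntry rels).size + B.enc.size < N) :
    ComputesWithin (computeAllSolutions dm) (.inr .column)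
      (.cons X (.cons (encList encEntry rels) B.enc)) (encRel (columnRel X B rels))
      (cst 3 N) := by
  refine .of_cstIter rels.length
    (by have := length_lt_size_encList encEntry rels; omega) ?_
  induction rels with
  | nil =>
    have h₁ : 3 * cst 1 N + 60 * (N + 1) ≤ cst 2 N := cst_le_succ 1 N
    simp [FinStr.enc_eq] at h
    apply computesWithin_of_silent
    simp [FinStr.enc_eq]
    exact ⟨_, computes_unary dm (N := N) B.univ (by omega), by omega⟩
  | cons e rest ih =>
    have h₁ : 3 * cst 1 N + 60 * (N + 1) ≤ cst 2 N := cst_le_succ 1 N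
    have h₂ := size_findTuple_le X e.2
    have h₃ := size_lookupRel_le e.1 B.rels
    simp [encEntry] at h
    apply computesWithin_of_silent
    simp [encEntry]
    refine ⟨_, _, computes_findTuple dm (N := N) X e.2 (by omega), ?_⟩
    simp only [columnRel]
    cases ht : findTuple X e.2 with
    | nil =>
      simp
      exact ⟨_, ih (by omega), by omega⟩
    | cons y ys =>
      rw [ht] at h₂
      simp [FinStr.enc_eq] at h h₂ ⊢
      refine ⟨_, _, computes_lookup dm (N := N) e.1 B.rels (by omega), _,
        computes_project dm (N := N) X (y :: ys) _ (by simp; omega), by omega⟩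

/-- Does `u' j = a` hold for all `j` with `s' j = x`? -/
def agreesAt (x a : Name) : List Name → List Name → Bool
  | y :: ys, b :: bs => (x ≠ y || a = b) && agreesAt x a ys bs
  | _, _ => true

theorem computes_agreeAt {N : ℕ} (x a : Name) (s' u' : List Name)
    (h : x.size + a.size + (Data.ofList s').size + (Data.ofList u').size < N) :
    ComputesWithin (computeAllSolutions dm) (.inr .agreeAt)
      (.cons x (.cons a (.cons (Data.ofList s') (Data.ofList u'))))
      (Data.ofProp (agreesAt x a s' u')) (cst 1 N) := by
  refine .of_cstIter s'.length (by have := Data.length_lt_size s'; omega) ?_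
  induction s' generalizing u' with
  | nil =>
    apply computesWithin_of_silent
    simp [agreesAt] at h ⊢
    omega
  | cons y ys ih =>
    apply computesWithin_of_silent
    cases u' with
    | nil =>
      simp [agreesAt] at h ⊢
      omega
    | cons b bs =>
      simp at h
      by_cases hx : x = y
      · by_cases ha : a = b
        · simp [agreesAt, hx, ha] at ih h ⊢
          exact ⟨_, ih bs (by omega), by omega⟩
        · simp [agreesAt, hx, ha, Data.ofProp_neg] at h ⊢
          omega
      · simp [agreesAt, hx, Data.ofProp_neg]
        exact ⟨_, ih bs (by omega), by omega⟩

/-- Does `u i = u' j` hold for all `i, j` with `s i = s' j`? -/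
def agrees (s' u' : List Name) : List Name → List Name → Bool
  | x :: xs, a :: as => agreesAt x a s' u' && agrees s' u' xs as
  | _, _ => true

theorem computes_agree {N : ℕ} (s u s' u' : List Name)
    (h : (Data.ofList s).size + (Data.ofList u).size + (Data.ofList s').size +
      (Data.ofList u').size < N) :
    ComputesWithin (computeAllSolutions dm) (.inr .agree)
      (.cons (Data.ofList s) (.cons (Data.ofList u) (.cons (Data.ofList s') (Data.ofList u'))))
      (Data.ofProp (agrees s' u' s u)) (cst 2 N) := by
  refine .of_cstIter s.length (by have := Data.length_lt_size s; omega) ?_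
  induction s generalizing u with
  | nil =>
    apply computesWithin_of_silent
    simp [agrees] at h ⊢
    omega
  | cons x xs ih =>
    apply computesWithin_of_silent
    cases u with
    | nil =>
      simp [agrees] at h ⊢
      omega
    | cons a as =>
      simp at h
      simp
      refine ⟨_, _, computes_agreeAt dm (N := N) x a s' u' (by omega), ?_⟩
      by_cases hx : agreesAt x a s' u' = true
      · simp [agrees, hx]
        exact ⟨_, ih as (by omega), by omega⟩
      · simp [agrees, hx]
        omega

/-- Does the tuple `u` over `s` agree, on the common variables, with some tuple over `s'` in the
relation `us`? -/
def supported (s u s' : List Name) (us : List (List Name)) : Bool :=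
  us.any fun u' => agrees s' u' s u

theorem computes_supported {N : ℕ} (s u s' : List Name) (us : List (List Name))
    (h : (Data.ofList s).size + (Data.ofList u).size + (Data.ofList s').size +
      (encRel us).size < N) :
    ComputesWithin (computeAllSolutions dm) (.inr .supported)
      (.cons (Data.ofList s) (.cons (Data.ofList u) (.cons (Data.ofList s') (encRel us))))
      (Data.ofProp (supported s u s' us)) (cst 3 N) := by
  refine .of_cstIter us.length
    (by have := length_lt_size_encList Data.ofList us; simp only [encRel] at h; omega) ?_
  induction us with
  | nil =>
    apply computesWithin_of_silent
    simp [supported] at h ⊢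
    omega
  | cons u' rest ih =>
    simp at h
    apply computesWithin_of_silent
    simp
    refine ⟨_, _, computes_agree dm (N := N) s u s' u' (by omega), ?_⟩
    unfold supported at ih ⊢
    by_cases hx : agrees s' u' s u = true
    · simp only [List.any_cons, hx]
      simp
      omega
    · simp only [List.any_cons, hx]
      simp only [Bool.false_or]
      simp
      exact ⟨_, by simpa using ih (by omega), by omega⟩

/-- Is the tuple `u` over `s` supported in all the views? -/
def supportedAll (V : List Table) (s u : List Name) : Bool :=
  V.all fun w => supported s u w.1.scope w.2

theorem computes_supportedAll {N : ℕ} (s u : List Name) (V : List Table)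
    (h : (Data.ofList s).size + (Data.ofList u).size + (encList Table.enc V).size < N) :
    ComputesWithin (computeAllSolutions dm) (.inr .supportedAll)
      (.cons (Data.ofList s) (.cons (Data.ofList u) (encList Table.enc V)))
      (Data.ofProp (supportedAll V s u)) (cst 4 N) := by
  refine .of_cstIter V.length
    (by have := length_lt_size_encList Table.enc V; omega) ?_
  induction V with
  | nil =>
    apply computesWithin_of_silent
    simp [supportedAll] at h ⊢
    omega
  | cons w rest ih =>
    simp [Table.enc, View.enc] at h
    apply computesWithin_of_silent
    simp [Table.enc, View.enc]
    refine ⟨_, _, computes_supported dm (N := N) s u w.1.scope w.2 (by omega), ?_⟩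
    unfold supportedAll at ih ⊢
    by_cases hx : supported s u w.1.scope w.2 = true
    · simp only [List.all_cons, hx, Bool.true_and]
      simp
      exact ⟨_, by simpa using ih (by omega), by omega⟩
    · simp only [List.all_cons, hx, Bool.false_and]
      simp
      omega

theorem computes_filterRel {N : ℕ} (s : List Name) (us : List (List Name)) (V : List Table)
    (h : (Data.ofList s).size + (encRel us).size + (encList Table.enc V).size < N) :
    ComputesWithin (computeAllSolutions dm) (.inr .filterRel)
      (.cons (Data.ofList s) (.cons (encRel us) (encList Table.enc V)))
      (encRel (us.filter (supportedAll V s))) (cst 5 N) := by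
  refine .of_cstIter us.length
    (by have := length_lt_size_encList Data.ofList us; simp only [encRel] at h; omega) ?_
  induction us with
  | nil =>
    apply computesWithin_of_silent
    simp at h ⊢
    omega
  | cons u rest ih =>
    have h₁ : (encRel (rest.filter (supportedAll V s))).size ≤ (encRel rest).size :=
      size_encList_le_of_sublist _ List.filter_sublist
    simp at h
    apply computesWithin_of_silent
    simp
    refine ⟨_, _, ih (by omega), _, _,
      computes_supportedAll dm (N := N) s u V (by omega), ?_⟩
    by_cases hx : supportedAll V s u = true
    · simp [hx]
      omega
    · simp [hx]
      omega

/-- One round of filtering all the relations in `W`. -/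
def reviseRels (V W : List Table) : List Table :=
  W.map fun w => (w.1, w.2.filter (supportedAll V w.1.scope))

theorem size_reviseRels_le (V W : List Table) :
    (encList Table.enc (reviseRels V W)).size ≤ (encList Table.enc W).size := by
  induction W with
  | nil => simp [reviseRels]
  | cons w W ih =>
    have h₁ : (encRel (w.2.filter (supportedAll V w.1.scope))).size ≤ (encRel w.2).size :=
      size_encList_le_of_sublist _ List.filter_sublist
    simp [reviseRels, Table.enc] at ih ⊢
    omega

theorem computes_revise {N : ℕ} (V W : List Table)
    (h : (encList Table.enc W).size + (encList Table.enc V).size < N) :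
    ComputesWithin (computeAllSolutions dm) (.inr .revise)
      (.cons (encList Table.enc W) (encList Table.enc V))
      (encList Table.enc (reviseRels V W)) (cst 6 N) := by
  refine .of_cstIter W.length
    (by have := length_lt_size_encList Table.enc W; omega) ?_
  induction W with
  | nil =>
    apply computesWithin_of_silent
    simp [reviseRels] at h ⊢
    omega
  | cons w rest ih =>
    have h₁ : (encRel (w.2.filter (supportedAll V w.1.scope))).size ≤ (encRel w.2).size :=
      size_encList_le_of_sublist _ List.filter_sublist
    have h₂ := size_reviseRels_le V rest
    simp only [reviseRels] at ih h₂ ⊢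
    simp [Table.enc, View.enc] at h
    apply computesWithin_of_silent
    simp [Table.enc, View.enc]
    refine ⟨_, computes_filterRel dm (N := N) w.1.scope w.2 V (by omega), _,
      by simpa [Table.enc, View.enc] using ih (by omega), ?_⟩
    omega

/-- The number of all tuples. -/
def numTuples (V : List Table) : ℕ := (V.map fun w => w.2.length).sum

theorem numTuples_lt_size (V : List Table) : numTuples V < (encList Table.enc V).size := by
  induction V with
  | nil => simp [numTuples]
  | cons w V ih =>
    have := length_lt_size_encList Data.ofList w.2
    simp [numTuples, Table.enc, encRel] at ih this ⊢
    omega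

theorem numTuples_reviseRels_le (V W : List Table) : numTuples (reviseRels V W) ≤ numTuples W := by
  induction W with
  | nil => simp [reviseRels, numTuples]
  | cons w W ih =>
    have h₁ := List.length_filter_le (supportedAll V w.1.scope) w.2
    simp only [numTuples, reviseRels, List.map_cons, List.sum_cons] at ih ⊢
    omega

/-- A filtered list of unchanged length is the list itself, so a round that changes anything deletes
a tuple. This is the termination measure of arc consistency. -/
theorem numTuples_reviseRels_lt {V W : List Table} (h : reviseRels V W ≠ W) :
    numTuples (reviseRels V W) < numTuples W := by
  induction W with
  | nil => simp [reviseRels] at h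
  | cons w W ih =>
    have h₁ := List.length_filter_le (supportedAll V w.1.scope) w.2
    have h₂ := numTuples_reviseRels_le V W
    by_cases hw : w.2.filter (supportedAll V w.1.scope) = w.2
    · have h₃ : reviseRels V W ≠ W := by
        intro h'
        apply h
        simp only [reviseRels, List.map_cons] at h' ⊢
        rw [h', hw]
      have := ih h₃
      simp only [numTuples, reviseRels, List.map_cons, List.sum_cons] at this ⊢
      omega
    · have h₃ : (w.2.filter (supportedAll V w.1.scope)).length ≠ w.2.length :=
        fun h' => hw (List.filter_sublist.eq_of_length h')
      simp only [numTuples, reviseRels, List.map_cons, List.sum_cons] at h₂ ⊢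
      omega

/-- The result is given as an iterate of `reviseRels`, so that whatever one round preserves holds
for it. The factor `2` is there because `revise` receives two copies of the family. -/
theorem computes_gac {N : ℕ} (V : List Table) (h : 2 * (encList Table.enc V).size < N) :
    ∃ n, reviseRels ((fun V => reviseRels V V)^[n] V) ((fun V => reviseRels V V)^[n] V) =
        (fun V => reviseRels V V)^[n] V ∧
      ComputesWithin (computeAllSolutions dm) (.inr .gac) (encList Table.enc V)
        (encList Table.enc ((fun V => reviseRels V V)^[n] V)) (cst 7 N) := by
  -- Induction on a bound `m` for the number of tuples: each round that changes the family uses up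
  -- at least one.
  suffices H : ∀ m, numTuples V ≤ m → ∃ n,
      reviseRels ((fun V => reviseRels V V)^[n] V) ((fun V => reviseRels V V)^[n] V) =
        (fun V => reviseRels V V)^[n] V ∧
      ComputesWithin (computeAllSolutions dm) (.inr .gac) (encList Table.enc V)
        (encList Table.enc ((fun V => reviseRels V V)^[n] V)) (cstIter 6 N m) by
    obtain ⟨n, h₁, h₂⟩ := H _ le_rfl
    exact ⟨n, h₁, h₂.of_cstIter _ (by have := numTuples_lt_size V; omega)⟩
  intro m
  induction m generalizing V with
  | zero =>
    intro hm
    have hV : reviseRels V V = V := by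
      by_contra hV
      have := numTuples_reviseRels_lt hV
      omega
    refine ⟨0, hV, ?_⟩
    apply computesWithin_of_silent
    simp
    refine ⟨_, _, computes_revise dm (N := N) V V (by omega), ?_⟩
    simp [hV]
    omega
  | succ m ih =>
    intro hm
    by_cases hV : reviseRels V V = V
    · refine ⟨0, hV, ?_⟩
      apply computesWithin_of_silent
      simp
      refine ⟨_, _, computes_revise dm (N := N) V V (by omega), ?_⟩
      simp [hV]
      omega
    · have h₁ := numTuples_reviseRels_lt hV
      have h₂ := size_reviseRels_le V V
      obtain ⟨n, hn, h'⟩ := ih (reviseRels V V) (by omega) (by omega)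
      refine ⟨n + 1, hn, ?_⟩
      apply computesWithin_of_silent
      simp
      refine ⟨_, _, computes_revise dm (N := N) V V (by omega), ?_⟩
      simp [(encList_injective Table.enc_injective).eq_iff, hV, Data.ofProp_neg]
      exact ⟨_, h', by omega⟩

theorem computes_allNonempty {N : ℕ} (V : List Table) (h : (encList Table.enc V).size < N) :
    ComputesWithin (computeAllSolutions dm) (.inr .allNonempty) (encList Table.enc V)
      (Data.ofProp (∀ w ∈ V, w.2 ≠ [])) (cst 1 N) := by
  refine .of_cstIter V.length
    (by have := length_lt_size_encList Table.enc V; omega) ?_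
  induction V with
  | nil =>
    apply computesWithin_of_silent
    simp at h ⊢
    omega
  | cons w rest ih =>
    simp [Table.enc] at h
    apply computesWithin_of_silent
    rcases w with ⟨v, _ | ⟨u, us⟩⟩
    · rw [Data.ofProp_neg (by simp)]
      simp [Table.enc] at h ⊢
      omega
    · rw [Data.ofProp_congr (show (∀ w ∈ (v, u :: us) :: rest, w.2 ≠ []) ↔ ∀ w ∈ rest, w.2 ≠ []
        by simp)]
      simp [Table.enc] at h ⊢
      exact ⟨_, by simpa using ih (by omega), by omega⟩

theorem size_zip_le (V : List View) (W : List (List (List Name))) :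
    (encList Table.enc (V.zip W)).size ≤ (encList View.enc V).size + (encList encRel W).size := by
  induction V generalizing W with
  | nil => simp
  | cons v V ih =>
    cases W with
    | nil => simp
    | cons r W =>
      have := ih W
      simp [Table.enc]
      omega

theorem computes_zip {N : ℕ} (V : List View) (W : List (List (List Name)))
    (h : (encList View.enc V).size + (encList encRel W).size < N) :
    ComputesWithin (computeAllSolutions dm) (.inr .zip)
      (.cons (encList View.enc V) (encList encRel W)) (encList Table.enc (V.zip W)) (cst 1 N) := by
  refine .of_cstIter V.length
    (by have := length_lt_size_encList View.enc V; omega) ?_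
  induction V generalizing W with
  | nil =>
    apply computesWithin_of_silent
    simp at h ⊢
    omega
  | cons v V ih =>
    apply computesWithin_of_silent
    cases W with
    | nil =>
      simp at h ⊢
      omega
    | cons r W =>
      have := size_zip_le V W
      simp at h
      simp [Table.enc]
      exact ⟨_, ih W (by omega), by omega⟩

/-- The relation of the first base view for the symbol `R`. -/
def domRel (R : Sym) : List Table → List (List Name)
  | [] => []
  | w :: rest => if R ∈ w.1.base then w.2 else domRel R rest

theorem mem_map_encSym {R : Sym} {b : List Sym} : encSym R ∈ b.map encSym ↔ R ∈ b :=
  List.mem_map_of_injective encSym_injective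

theorem computes_domRel {N : ℕ} (R : Sym) (V : List Table)
    (h : (encSym R).size + (encList Table.enc V).size < N) :
    ComputesWithin (computeAllSolutions dm) (.inr .domRel)
      (.cons (encSym R) (encList Table.enc V)) (encRel (domRel R V)) (cst 2 N) := by
  refine .of_cstIter V.length
    (by have := length_lt_size_encList Table.enc V; omega) ?_
  induction V with
  | nil =>
    apply computesWithin_of_silent
    simp [domRel] at h ⊢
    omega
  | cons w rest ih =>
    simp [Table.enc, View.enc] at h
    apply computesWithin_of_silent
    simp [Table.enc, View.enc]
    refine ⟨_, _, computes_mem dm (N := N) (encSym R) (w.1.base.map encSym)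
      (by simp only [encList] at h; omega), ?_⟩
    simp only [mem_map_encSym]
    by_cases hR : R ∈ w.1.base
    · simp [domRel, hR]
      omega
    · simp [domRel, hR]
      exact ⟨_, ih (by omega), by omega⟩

theorem computes_values {N : ℕ} (as : List Name) (h : 3 * (Data.ofList as).size < N) :
    ComputesWithin (computeAllSolutions dm) (.inr .values)
      (encRel (as.map ([·]))) (Data.ofList as.dedup) (cst 2 N) := by
  refine .of_cstIter as.length (by have := Data.length_lt_size as; omega) ?_
  induction as with
  | nil =>
    apply computesWithin_of_silent
    simp at h ⊢
    omega
  | cons a as ih =>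
    have h₁ := size_encRel_map_singleton_le as
    have h₂ := Data.size_ofList_le_of_sublist as.dedup_sublist
    simp at h
    apply computesWithin_of_silent
    simp
    refine ⟨_, _, ih (by omega), _, _, computes_mem dm (N := N) a as.dedup (by omega), ?_⟩
    by_cases ha : a ∈ as
    · simp [ha]
      omega
    · simp [ha]
      omega

/-- The relation of the first base view for the symbol `R` is replaced with `{⟨a⟩}`. -/
def fixRel (R : Sym) (a : Name) : List Table → List Table
  | [] => []
  | w :: rest => if R ∈ w.1.base then (w.1, [[a]]) :: rest else w :: fixRel R a rest

/-- Crude, but valid for any `a`; it suffices for the time of one call. The encoding of `{⟨a⟩}`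
accounts for `a.size + 4`. -/
theorem size_fixRel_le (R : Sym) (a : Name) (V : List Table) :
    (encList Table.enc (fixRel R a V)).size ≤ (encList Table.enc V).size + a.size + 4 := by
  induction V with
  | nil => simp [fixRel]
  | cons w V ih =>
    by_cases hR : R ∈ w.1.base
    · have := (encRel w.2).size_pos
      simp [fixRel, hR, Table.enc]
      omega
    · simp [fixRel, hR]
      omega

theorem computes_fixDom {N : ℕ} (R : Sym) (a : Name) (V : List Table)
    (h : (encSym R).size + a.size + (encList Table.enc V).size < N) :
    ComputesWithin (computeAllSolutions dm) (.inr .fixDom)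
      (.cons (encSym R) (.cons a (encList Table.enc V))) (encList Table.enc (fixRel R a V))
      (cst 2 N) := by
  refine .of_cstIter V.length
    (by have := length_lt_size_encList Table.enc V; omega) ?_
  induction V with
  | nil =>
    apply computesWithin_of_silent
    simp [fixRel] at h ⊢
    omega
  | cons w rest ih =>
    have h₁ := size_fixRel_le R a rest
    simp [Table.enc, View.enc] at h
    apply computesWithin_of_silent
    simp [Table.enc, View.enc]
    refine ⟨_, _, computes_mem dm (N := N) (encSym R) (w.1.base.map encSym)
      (by simp only [encList] at h; omega), ?_⟩
    simp only [mem_map_encSym]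
    by_cases hR : R ∈ w.1.base
    · simp [fixRel, hR, Table.enc, View.enc]
      omega
    · simp [fixRel, hR, Table.enc, View.enc]
      exact ⟨_, ih (by omega), by omega⟩

end

/-! ## The domain-restricted version of an instance -/

section

theorem pickAt_mem {X : Name} {t u : List Name} (hX : X ∈ t) (h : t.length = u.length) :
    pickAt X t u ∈ u := by
  induction t generalizing u with
  | nil => simp at hX
  | cons y ys ih =>
    cases u with
    | nil => simp at h
    | cons a as =>
      simp only [pickAt]
      split_ifs with hXy
      · simp
      · exact List.mem_cons_of_mem _ (ih ((List.mem_cons.1 hX).resolve_left hXy) (by simpa using h))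

theorem pickAt_map {X : Name} {t : List Name} (hX : X ∈ t) (h : Name → Name) :
    pickAt X t (t.map h) = h X := by
  induction t with
  | nil => simp at hX
  | cons y ys ih =>
    simp only [pickAt, List.map_cons]
    split_ifs with hXy
    · rw [hXy]
    · exact ih ((List.mem_cons.1 hX).resolve_left hXy)

theorem lookupRel_eq_nil_or_mem (R : Sym) (rels : List (Sym × List (List Name))) :
    lookupRel R rels = [] ∨ (R, lookupRel R rels) ∈ rels := by
  induction rels with
  | nil => simp [lookupRel]
  | cons e rest ih =>
    simp only [lookupRel]
    split_ifs with hR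
    · subst hR; simp
    · exact ih.imp_right (List.mem_cons_of_mem _)

theorem mem_lookupRel {R : Sym} {rels : List (Sym × List (List Name))}
    (h : (rels.map Prod.fst).Nodup) {r : List (List Name)} (hr : (R, r) ∈ rels) :
    lookupRel R rels = r := by
  induction rels with
  | nil => simp at hr
  | cons e rest ih =>
    simp only [List.map_cons, List.nodup_cons] at h
    simp only [lookupRel]
    rcases List.mem_cons.1 hr with rfl | hr
    · simp
    · rw [if_neg]
      · exact ih h.2 hr
      · rintro rfl
        exact h.1 (List.mem_map.2 ⟨_, hr, rfl⟩)

theorem FinStr.WellFormed.mem_rel_iff {B : FinStr} (hB : B.WellFormed) {R : Sym} {u : List Name} :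
    u ∈ B.rel R ↔ u ∈ lookupRel R B.rels := by
  constructor
  · rintro ⟨⟨_, r⟩, hp, rfl, hu⟩
    rwa [mem_lookupRel hB.1 hp]
  · intro hu
    rcases lookupRel_eq_nil_or_mem R B.rels with h | h
    · simp [h] at hu
    · exact ⟨_, h, rfl, hu⟩

theorem findTuple_mem {X : Name} {ts : List (List Name)} (h : findTuple X ts ≠ []) :
    findTuple X ts ∈ ts ∧ X ∈ findTuple X ts := by
  induction ts with
  | nil => simp [findTuple] at h
  | cons t ts ih =>
    simp only [findTuple] at h ⊢
    split_ifs at h ⊢ with hX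
    · exact ⟨List.mem_cons_self, hX⟩
    · exact ⟨List.mem_cons_of_mem _ (ih h).1, (ih h).2⟩

theorem columnRel_cases (X : Name) (B : FinStr) (rels : List (Sym × List (List Name))) :
    columnRel X B rels = B.univ.map ([·]) ∨
      ∃ e ∈ rels, ∃ t ∈ e.2, X ∈ t ∧
        columnRel X B rels = (lookupRel e.1 B.rels).map fun u => [pickAt X t u] := by
  induction rels with
  | nil => exact .inl rfl
  | cons e rest ih =>
    simp only [columnRel]
    split_ifs with h
    · rcases ih with ih | ⟨e', he', ih⟩
      · exact .inl ih
      · exact .inr ⟨e', List.mem_cons_of_mem _ he', ih⟩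
    · exact .inr ⟨e, List.mem_cons_self, _, (findTuple_mem h).1, (findTuple_mem h).2, rfl⟩

/-- `M` bounds the sizes of the relations and of the unary relation with all elements. -/
def FinStr.RelsBounded (B : FinStr) (M : ℕ) : Prop :=
  (encRel (B.univ.map ([·]))).size ≤ M ∧ ∀ p ∈ B.rels, (encRel p.2).size ≤ M

theorem FinStr.relsBounded_enc (B : FinStr) : B.RelsBounded (3 * B.enc.size) := by
  constructor
  · have := size_encRel_map_singleton_le B.univ
    simp [enc_eq]
    omega
  · intro p hp
    have := size_lt_of_mem_encList encEntry hp
    simp [enc_eq, encEntry] at this ⊢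
    omega

/-! ### Adding one domain constraint to an instance. -/

variable {A B : FinStr} {X : Name}

theorem length_eq_of_mem_rel (h : IsInstance A B) {R : Sym} {t u : List Name} (ht : t ∈ A.rel R)
    (hu : u ∈ B.rel R) : t.length = u.length := by
  obtain ⟨k, h₁, h₂⟩ := h.2.2.2.2 R
  rw [h₁ t ht, h₂ u hu]

theorem mem_columnRel (h : IsInstance A B) {u : List Name} (hu : u ∈ columnRel X B A.rels) :
    ∃ b ∈ B.univ, u = [b] := by
  rcases columnRel_cases X B A.rels with hc | ⟨e, he, t, ht, hX, hc⟩
  · rw [hc, List.mem_map] at hu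
    obtain ⟨b, hb, rfl⟩ := hu
    exact ⟨b, hb, rfl⟩
  · rw [hc, List.mem_map] at hu
    obtain ⟨w, hw, rfl⟩ := hu
    rw [← h.2.1.mem_rel_iff] at hw
    refine ⟨_, h.2.1.2.2 _ w hw _ (pickAt_mem hX ?_), rfl⟩
    exact length_eq_of_mem_rel h ⟨e, he, rfl, ht⟩ hw

/-- A homomorphism maps a tuple that contains `X` into the relation of `B`, where the entry at the
position of `X` is its value at `X`. -/
theorem hom_mem_columnRel (h : IsInstance A B) (hX : X ∈ A.univ) {f : Name → Name}
    (hf : Str.IsHom f A.toStr B.toStr) : [f X] ∈ columnRel X B A.rels := by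
  rcases columnRel_cases X B A.rels with hc | ⟨e, he, t, ht, hXt, hc⟩
  · rw [hc, List.mem_map]
    exact ⟨f X, hf.1 X hX, rfl⟩
  · rw [hc, List.mem_map]
    exact ⟨t.map f, h.2.1.mem_rel_iff.1 (hf.2 e.1 t ⟨e, he, rfl, ht⟩), by rw [pickAt_map hXt]⟩

/-- The tuples of the relation have the length of the scope, so the picked entry is an entry of the
tuple and the column is no larger than the relation. The factor `3` of `size_encRel_map_pickAt_le`
would instead compound when one added column is computed from another. -/
theorem size_columnRel_le (h : IsInstance A B) {M : ℕ} (hM : B.RelsBounded M) :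
    (encRel (columnRel X B A.rels)).size ≤ M := by
  rcases columnRel_cases X B A.rels with hc | ⟨e, he, t, ht, hXt, hc⟩
  · rw [hc]
    exact hM.1
  · rw [hc]
    have key : ∀ us : List (List Name), (∀ u ∈ us, t.length = u.length) →
        (encRel (us.map fun u => [pickAt X t u])).size ≤ (encRel us).size := by
      intro us hus
      induction us with
      | nil => simp
      | cons u us ih =>
        have h₁ := ih fun u hu => hus u (List.mem_cons_of_mem _ hu)
        have h₂ := Data.size_lt_of_mem (pickAt_mem hXt (hus u List.mem_cons_self))
        simp
        omega
    refine (key _ fun u hu =>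
      length_eq_of_mem_rel h ⟨e, he, rfl, ht⟩ (h.2.1.mem_rel_iff.2 hu)).trans ?_
    rcases lookupRel_eq_nil_or_mem e.1 B.rels with hl | hl
    · rw [hl]
      exact (Data.size_pos _).trans_le hM.1
    · exact hM.2 _ hl

/-- The structure with the relation `r` for the symbol `R` added. -/
def FinStr.addRel (A : FinStr) (R : Sym) (r : List (List Name)) : FinStr :=
  ⟨A.univ, (R, r) :: A.rels⟩

theorem FinStr.mem_addRel {A : FinStr} {R S : Sym} {r : List (List Name)} {t : List Name} :
    t ∈ (A.addRel R r).rel S ↔ (R = S ∧ t ∈ r) ∨ t ∈ A.rel S := by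
  simp [addRel, rel]

theorem FinStr.mem_voc_of_mem_rel {A : FinStr} {R : Sym} {t : List Name} (h : t ∈ A.rel R) :
    R ∈ A.voc := by
  obtain ⟨p, hp, rfl, -⟩ := h
  exact List.mem_map_of_mem hp

theorem FinStr.rel_addRel_self {A : FinStr} {R : Sym} {r : List (List Name)} (hR : R ∉ A.voc) :
    (A.addRel R r).rel R = {t | t ∈ r} := by
  ext t
  rw [mem_addRel]
  constructor
  · rintro (⟨-, h⟩ | h)
    · exact h
    · exact absurd (mem_voc_of_mem_rel h) hR
  · exact fun h => .inl ⟨rfl, h⟩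

theorem FinStr.rel_addRel_of_ne {A : FinStr} {R S : Sym} {r : List (List Name)} (hR : R ≠ S) :
    (A.addRel R r).rel S = A.rel S := by
  ext t
  rw [mem_addRel]
  exact ⟨fun h => h.resolve_left fun h => hR h.1, .inr⟩

theorem FinStr.WellFormed.addRel {A : FinStr} (hA : A.WellFormed) {R : Sym} (hR : R ∉ A.voc)
    {r : List (List Name)} (hr : ∀ t ∈ r, ∃ a ∈ A.univ, t = [a]) : (A.addRel R r).WellFormed := by
  refine ⟨List.nodup_cons.2 ⟨hR, hA.1⟩, fun S => ?_, fun S t ht => ?_⟩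
  · by_cases h : R = S
    · subst h
      refine ⟨1, fun t ht => ?_⟩
      rw [rel_addRel_self hR] at ht
      obtain ⟨a, -, rfl⟩ := hr t ht
      rfl
    · rw [rel_addRel_of_ne h]
      exact hA.2.1 S
  · by_cases h : R = S
    · subst h
      rw [rel_addRel_self hR] at ht
      obtain ⟨a, ha, rfl⟩ := hr t ht
      intro x hx
      rw [List.mem_singleton.1 hx]
      exact ha
    · rw [rel_addRel_of_ne h] at ht
      exact hA.2.2 S t ht

theorem IsInstance.addDom (h : IsInstance A B) (hX : X ∈ A.univ) (hd : Sym.dom X ∉ A.voc) :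
    IsInstance (A.addRel (.dom X) [[X]]) (B.addRel (.dom X) (columnRel X B A.rels)) := by
  have hd' : Sym.dom X ∉ B.voc := fun h' => hd ((h.2.2.2.1 _).2 h')
  refine ⟨⟨h.1.1.addRel hd (by simpa using hX), fun Y hY => ?_⟩,
    h.2.1.addRel hd' fun u hu => mem_columnRel h hu, h.2.2.1, fun R => ?_, fun R => ?_⟩
  · by_cases hXY : X = Y
    · subst hXY
      rw [FinStr.rel_addRel_self hd]
      ext t; simp
    · have hne : Sym.dom X ≠ .dom Y := by simpa using hXY
      rw [FinStr.rel_addRel_of_ne hne]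
      exact h.1.2 Y ((List.mem_cons.1 hY).resolve_left hne.symm)
  · have := h.2.2.2.1 R
    simp only [FinStr.voc, FinStr.addRel, List.map_cons, List.mem_cons] at this ⊢
    rw [this]
  · by_cases hR : Sym.dom X = R
    · subst hR
      rw [FinStr.rel_addRel_self hd, FinStr.rel_addRel_self hd']
      refine ⟨1, by simp, fun u hu => ?_⟩
      obtain ⟨b, -, rfl⟩ := mem_columnRel h hu
      rfl
    · rw [FinStr.rel_addRel_of_ne hR, FinStr.rel_addRel_of_ne hR]
      exact h.2.2.2.2 R

/-- The new relation is a fresh one, and it already contains the value of `X` under every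
homomorphism; so the new constraint excludes nothing. -/
theorem isHom_addDom (h : IsInstance A B) (hX : X ∈ A.univ) (hd : Sym.dom X ∉ A.voc)
    (f : Name → Name) :
    Str.IsHom f (A.addRel (.dom X) [[X]]).toStr
      (B.addRel (.dom X) (columnRel X B A.rels)).toStr ↔ Str.IsHom f A.toStr B.toStr := by
  have hd' : Sym.dom X ∉ B.voc := fun h' => hd ((h.2.2.2.1 _).2 h')
  constructor
  · rintro ⟨h₁, h₂⟩
    refine ⟨h₁, fun R t ht => ?_⟩
    have hR : Sym.dom X ≠ R := by
      rintro rfl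
      exact hd (FinStr.mem_voc_of_mem_rel ht)
    have := h₂ R t (FinStr.mem_addRel.2 (.inr ht))
    exact (FinStr.mem_addRel.1 this).resolve_left fun h => hR h.1
  · intro hf
    refine ⟨hf.1, fun R t ht => FinStr.mem_addRel.2 ?_⟩
    rcases FinStr.mem_addRel.1 ht with ⟨rfl, ht'⟩ | ht
    · left
      obtain rfl : t = [X] := List.mem_singleton.1 ht'
      exact ⟨rfl, hom_mem_columnRel h hX hf⟩
    · exact .inr (hf.2 R t ht)

/-- The domain-restricted version of `(A, B, O)`. -/
def restrictPair : List Name → FinStr → FinStr → FinStr × FinStr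
  | [], A, B => (A, B)
  | X :: O, A, B =>
    if Sym.dom X ∈ A.voc then restrictPair O A B
    else restrictPair O (A.addRel (.dom X) [[X]]) (B.addRel (.dom X) (columnRel X B A.rels))

theorem restrictPair_fst (O : List Name) (A B : FinStr) :
    (restrictPair O A B).1 = A.domRestrict O := by
  induction O generalizing A B with
  | nil => rfl
  | cons X O ih =>
    simp only [restrictPair, FinStr.domRestrict]
    split_ifs
    · exact ih _ _
    · exact ih _ _

/-- What holds for the domain-restricted version `(A', B')` of `(A, B, O)`. -/
structure IsRestriction (A B : FinStr) (O : List Name) (A' B' : FinStr) : Prop where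
  isInstance : IsInstance A' B'
  isHom_iff : ∀ f, Str.IsHom f A'.toStr B'.toStr ↔ Str.IsHom f A.toStr B.toStr
  rel_subset : ∀ R, A.rel R ⊆ A'.rel R
  voc_subset : ∀ R ∈ A.voc, R ∈ A'.voc
  rel_subset_right : ∀ R ∈ A.voc, B'.rel R ⊆ B.rel R
  dom_mem : ∀ X ∈ O, Sym.dom X ∈ A'.voc
  univ_eq : B'.univ = B.univ

theorem isRestriction_restrictPair {O : List Name} (h : IsInstance A B)
    (hO : ∀ X ∈ O, X ∈ A.univ) :
    IsRestriction A B O (restrictPair O A B).1 (restrictPair O A B).2 := by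
  induction O generalizing A B with
  | nil => exact ⟨h, fun _ => .rfl, fun _ => subset_rfl, fun _ h => h, fun _ _ => subset_rfl,
      by simp, rfl⟩
  | cons X O ih =>
    have hO' : ∀ X ∈ O, X ∈ A.univ := fun X hX => hO X (List.mem_cons_of_mem _ hX)
    simp only [restrictPair]
    split_ifs with hd
    · have := ih h hO'
      exact ⟨this.1, this.2, this.3, this.4, this.5,
        List.forall_mem_cons.2 ⟨this.4 _ hd, this.6⟩, this.7⟩
    · have hX := hO X List.mem_cons_self
      have := ih (h.addDom hX hd) hO'
      refine ⟨this.1, fun f => (this.2 f).trans (isHom_addDom h hX hd f), fun R t ht =>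
        this.3 R (FinStr.mem_addRel.2 (.inr ht)), fun R hR =>
        this.4 R (List.mem_cons_of_mem _ hR), fun R hR u hu => ?_,
        List.forall_mem_cons.2 ⟨this.4 _ List.mem_cons_self, this.6⟩, this.7⟩
      have := this.5 R (List.mem_cons_of_mem _ hR) hu
      refine (FinStr.mem_addRel.1 this).resolve_left ?_
      rintro ⟨rfl, -⟩
      exact hd hR

/-- Every added relation of the right structure is bounded by the same `M`, so the total size grows
only linearly with the number of variables. Each `X` is copied three times per step, which `4 *
(Data.ofList O).size` covers. -/
theorem restrictPair_cost (dm : DecompositionMethod) {N M : ℕ} {O : List Name}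
    (h : IsInstance A B) (hO : ∀ X ∈ O, X ∈ A.univ) (hM : B.RelsBounded M)
    (hN : 4 * (Data.ofList O).size + A.enc.size + B.enc.size + O.length * (M + 30) < N) :
    ComputesWithin (computeAllSolutions dm) (.inr .restrict)
        (.cons (Data.ofList O) (.cons A.enc B.enc))
        (.cons (restrictPair O A B).1.enc (restrictPair O A B).2.enc) (cst 4 N) ∧
      (restrictPair O A B).1.enc.size + (restrictPair O A B).2.enc.size < N := by
  suffices H : ComputesWithin (computeAllSolutions dm) (.inr .restrict)
        (.cons (Data.ofList O) (.cons A.enc B.enc))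
        (.cons (restrictPair O A B).1.enc (restrictPair O A B).2.enc) (cstIter 3 N O.length) ∧
      (restrictPair O A B).1.enc.size + (restrictPair O A B).2.enc.size < N from
    ⟨H.1.of_cstIter _ (by have := Data.length_lt_size O; omega), H.2⟩
  induction O generalizing A B with
  | nil =>
    simp [restrictPair] at hN ⊢
    refine ⟨?_, by omega⟩
    apply computesWithin_of_silent
    simp
    omega
  | cons X O ih =>
    have hO' : ∀ X ∈ O, X ∈ A.univ := fun X hX => hO X (List.mem_cons_of_mem _ hX)
    have h₁ : 3 * cst 1 N + 60 * (N + 1) ≤ cst 2 N := cst_le_succ 1 N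
    have h₂ : 3 * cst 2 N + 60 * (N + 1) ≤ cst 3 N := cst_le_succ 2 N
    have h₃ := Data.size_pos B.enc
    simp only [Data.ofList_cons, Data.size_cons, List.length_cons, add_mul, one_mul] at hN
    have hN' := hN
    simp [FinStr.enc_eq] at hN'
    have hhas := computes_hasSym dm (N := N) (.dom X) A.rels (by simp [encSym]; omega)
    by_cases hd : Sym.dom X ∈ A.voc
    · obtain ⟨h₄, h₅⟩ := ih h hO' hM (by omega)
      simp only [restrictPair, if_pos hd]
      refine ⟨?_, h₅⟩
      apply computesWithin_of_silent
      simp [FinStr.enc_eq]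
      refine ⟨_, _, hhas, ?_⟩
      rw [Data.ofProp_pos (show Sym.dom X ∈ A.rels.map Prod.fst from hd)]
      simp
      refine ⟨_, by simpa [FinStr.enc_eq] using h₄, ?_⟩
      omega
    · have hX := hO X List.mem_cons_self
      have hc := size_columnRel_le (X := X) h hM
      -- The enlarged right structure satisfies `RelsBounded` with the unchanged `M`.
      obtain ⟨h₄, h₅⟩ := ih (h.addDom hX hd) hO' ⟨hM.1, List.forall_mem_cons.2 ⟨hc, hM.2⟩⟩ (by
        simp [FinStr.enc_eq, FinStr.addRel, encEntry, encSym]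
        omega)
      simp only [restrictPair, if_neg hd]
      refine ⟨?_, h₅⟩
      apply computesWithin_of_silent
      simp [FinStr.enc_eq]
      refine ⟨_, _, hhas, ?_⟩
      rw [Data.ofProp_neg (show Sym.dom X ∉ A.rels.map Prod.fst from hd)]
      simp
      refine ⟨_, _, by simpa [FinStr.enc_eq] using
        computes_column dm (N := N) X A.rels B (by simp [FinStr.enc_eq]; omega), ?_⟩
      refine ⟨_, by simpa [FinStr.enc_eq, FinStr.addRel, encEntry, encSym] using h₄, ?_⟩
      omega

end

/-! ## Consistent families of views -/

theorem agreesAt_iff {x a : Name} {s' u' : List Name} :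
    agreesAt x a s' u' = true ↔ ∀ p ∈ s'.zip u', x = p.1 → a = p.2 := by
  induction s' generalizing u' with
  | nil => simp [agreesAt]
  | cons y ys ih =>
    cases u' with
    | nil => simp [agreesAt]
    | cons b bs =>
      rw [agreesAt, Bool.and_eq_true, ih, List.zip_cons_cons, List.forall_mem_cons,
        Bool.or_eq_true, decide_eq_true_eq, decide_eq_true_eq, imp_iff_not_or]

theorem agrees_iff {s u s' u' : List Name} :
    agrees s' u' s u = true ↔ ∀ p ∈ s.zip u, ∀ q ∈ s'.zip u', p.1 = q.1 → p.2 = q.2 := by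
  induction s generalizing u with
  | nil => simp [agrees]
  | cons x xs ih =>
    cases u with
    | nil => simp [agrees]
    | cons a as => simp only [agrees, Bool.and_eq_true, agreesAt_iff, ih, List.zip_cons_cons,
        List.forall_mem_cons]

theorem mem_zip_map {s : List Name} {f : Name → Name} {p : Name × Name} :
    p ∈ s.zip (s.map f) ↔ p.1 ∈ s ∧ p.2 = f p.1 := by
  induction s with
  | nil => simp
  | cons x xs ih =>
    obtain ⟨a, b⟩ := p
    simp only [List.map_cons, List.zip_cons_cons, List.mem_cons, Prod.mk.injEq, ih]
    constructor
    · rintro (⟨rfl, rfl⟩ | ⟨h, rfl⟩) <;> simp_all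
    · rintro ⟨rfl | h, rfl⟩ <;> simp_all

theorem agrees_map_iff {s s' : List Name} {f f' : Name → Name} :
    agrees s' (s'.map f') s (s.map f) = true ↔ ∀ x ∈ s, x ∈ s' → f x = f' x := by
  rw [agrees_iff]
  constructor
  · intro h x hx hx'
    exact h (x, f x) (mem_zip_map.2 ⟨hx, rfl⟩) (x, f' x) (mem_zip_map.2 ⟨hx', rfl⟩) rfl
  · intro h p hp q hq hpq
    obtain ⟨hx, hx'⟩ := mem_zip_map.1 hp
    obtain ⟨hy, hy'⟩ := mem_zip_map.1 hq
    rw [hx', hy', ← hpq]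
    exact h _ hx (hpq ▸ hy)

theorem pickAt_mem_zip {X : Name} {t u : List Name} (hX : X ∈ t) (h : t.length = u.length) :
    (X, pickAt X t u) ∈ t.zip u := by
  induction t generalizing u with
  | nil => simp at hX
  | cons y ys ih =>
    cases u with
    | nil => simp at h
    | cons a as =>
      simp only [pickAt, List.zip_cons_cons, List.mem_cons]
      split_ifs with hXy
      · exact .inl (by rw [hXy])
      · exact .inr (ih ((List.mem_cons.1 hX).resolve_left hXy) (by simpa using h))

/-- The tuples of all views have the right length. -/
def HasArities (V : List Table) : Prop := ∀ w ∈ V, ∀ u ∈ w.2, u.length = w.1.scope.length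

/-- Generalized arc consistency. -/
def IsConsistent (V : List Table) : Prop := reviseRels V V = V

/-- A family is a fixed point of revision only if every filter keeps its whole list, that is, if
every tuple passes the test against every view. -/
theorem IsConsistent.supportedAll {V : List Table} (h : IsConsistent V) {w : Table} (hw : w ∈ V)
    {u : List Name} (hu : u ∈ w.2) {w' : Table} (hw' : w' ∈ V) :
    ∃ u' ∈ w'.2, agrees w'.1.scope u' w.1.scope u = true := by
  have h₁ : V.map (fun w => (w.1, w.2.filter (ECSP.supportedAll V w.1.scope))) = V.map id := by
    rw [List.map_id]
    exact h
  have h₂ := congrArg Prod.snd (List.map_inj_left.1 h₁ w hw)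
  have h₃ := List.filter_eq_self.1 h₂ u hu
  simpa [supported] using List.all_eq_true.1 h₃ w' hw'

/-- The tuples of a view in a consistent family are functions of the variables. -/
theorem IsConsistent.exists_map {V : List Table} (h : IsConsistent V) (hV : HasArities V)
    {w : Table} (hw : w ∈ V) {u : List Name} (hu : u ∈ w.2) : ∃ f, u = w.1.scope.map f := by
  obtain ⟨u', hu', hag⟩ := h.supportedAll hw hu hw
  rw [agrees_iff] at hag
  have hl := hV w hw u hu
  -- Scopes may repeat variables. Since `u` is supported in its own view by some `u'`, its entry at
  -- any position of `x` equals the entry of `u'` at the first position of `x`, hence depends on `x`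
  -- alone.
  refine ⟨fun x => pickAt x w.1.scope u', List.ext_getElem (by simpa using hl) fun i h₁ h₂ => ?_⟩
  rw [List.getElem_map]
  have h₃ : i < w.1.scope.length := hl ▸ h₁
  refine hag (w.1.scope[i], u[i]) ?_ (w.1.scope[i], _)
    (pickAt_mem_zip (List.getElem_mem h₃) (hV w hw u' hu').symm) rfl
  rw [← List.getElem_zip (h := by simp; omega)]
  exact List.getElem_mem _

/-- Consistency restated for functions on variables; this is the extension step of the gluing
argument. -/
theorem IsConsistent.exists_agree {V : List Table} (h : IsConsistent V) (hV : HasArities V)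
    {w w' : Table} (hw : w ∈ V) (hw' : w' ∈ V) {f : Name → Name} (hf : w.1.scope.map f ∈ w.2) :
    ∃ f', w'.1.scope.map f' ∈ w'.2 ∧ ∀ x ∈ w.1.scope, x ∈ w'.1.scope → f x = f' x := by
  obtain ⟨u', hu', hag⟩ := h.supportedAll hw hf hw'
  obtain ⟨f', rfl⟩ := h.exists_map hV hw' hu'
  exact ⟨f', hu', agrees_map_iff.1 hag⟩

/-! ## Gluing along a join tree -/

section Glue

variable {E N D : Type} {T : SimpleGraph E} {P : E → (N → D) → Prop}

/-- The functions that are chosen along a walk, from its end to its start. -/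
def glueWalk (g : ∀ e, {f // P e f}) (next : ∀ e e', {f // P e f} → {f // P e' f}) :
    ∀ {e e' : E}, T.Walk e e' → {f // P e f}
  | e, _, .nil => g e
  | _, _, .cons _ p => next _ _ (glueWalk g next p)

theorem eq_of_isPath (hT : T.IsAcyclic) {e e' : E} {p q : T.Walk e e'} (hp : p.IsPath)
    (hq : q.IsPath) : p = q :=
  congrArg Subtype.val ((hT.subsingleton_path e e').elim ⟨p, hp⟩ ⟨q, hq⟩)

/-- Paths in an acyclic graph are unique. If the path from `e'` to `r` meets `e`, it must start with
the edge to `e` and continue as `p`; otherwise the edge prepended to `p'` is a path, hence equal to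
`p`. So of two neighbours one is the next node on the way of the other to the root. -/
theorem eq_cons_or_eq_cons_of_adj (hT : T.IsAcyclic) {e e' r : E} (h : T.Adj e e')
    {p : T.Walk e r} {p' : T.Walk e' r} (hp : p.IsPath) (hp' : p'.IsPath) :
    p = .cons h p' ∨ p' = .cons h.symm p := by
  classical
  by_cases he : e ∈ p'.support
  · right
    have h₁ : p'.dropUntil e he = p :=
      eq_of_isPath hT (hp'.dropUntil he) hp
    have h₂ : p'.takeUntil e he = .cons h.symm .nil :=
      eq_of_isPath hT (hp'.takeUntil he) (SimpleGraph.Path.singleton h.symm).2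
    rw [← p'.take_spec he, h₁, h₂]
    rfl
  · left
    exact eq_of_isPath hT hp ((SimpleGraph.Walk.cons_isPath_iff h p').2 ⟨hp', he⟩)

/-- Functions on the nodes of a join tree that can be extended consistently to every other node
are glued to one function, starting from one of them. -/
theorem exists_glue (hT : T.Preconnected) (hT' : T.IsAcyclic) (s : E → Set N)
    (hs : ∀ (e e' : E) (X : N), X ∈ s e → X ∈ s e' →
      ∀ w : T.Walk e e', w.IsPath → ∀ g ∈ w.support, X ∈ s g)
    (hP : ∀ e e' f, P e f → ∃ f', P e' f' ∧ ∀ x ∈ s e, x ∈ s e' → f x = f' x)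
    (r : E) (f₀ : N → D) (hf₀ : P r f₀) :
    ∃ h : N → D, (∀ e, ∃ f, P e f ∧ ∀ x ∈ s e, h x = f x) ∧ ∀ x ∈ s r, h x = f₀ x := by
  classical
  have hnext : ∀ e e' (f : {f // P e f}), ∃ f' : {f // P e' f},
      ∀ x ∈ s e, x ∈ s e' → f.1 x = f'.1 x := fun e e' f => by
    obtain ⟨f', h, h'⟩ := hP e e' f.1 f.2
    exact ⟨⟨f', h⟩, h'⟩
  choose next next_spec using hnext
  -- Only the value of `g` at the root matters, as all walks used below end there; elsewhere any
  -- admissible function serves.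
  obtain ⟨g, hg⟩ : ∃ g : ∀ e, {f // P e f}, (g r).1 = f₀ := by
    refine ⟨Function.update (fun e => next r e ⟨f₀, hf₀⟩) r ⟨f₀, hf₀⟩, ?_⟩
    simp
  have path : ∀ e, ∃ p : T.Walk e r, p.IsPath := fun e =>
    ⟨(hT e r).some.toPath.1, (hT e r).some.toPath.2⟩
  choose p hp using path
  -- `U e` arises from `f₀` by extending it step by step along the path from the root to `e`.
  set U : ∀ e, {f // P e f} := fun e => glueWalk g next (p e) with hU
  have adj : ∀ {e e'}, T.Adj e e' → ∀ x ∈ s e, x ∈ s e' → (U e).1 x = (U e').1 x := by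
    intro e e' h x hx hx'
    rcases eq_cons_or_eq_cons_of_adj hT' h (hp e) (hp e') with h | h
    · have : U e = next _ _ (U e') := by simp only [hU, h, glueWalk]
      rw [this, next_spec e' e (U e') x hx' hx]
    · have : U e' = next _ _ (U e) := by simp only [hU, h, glueWalk]
      rw [this, next_spec e e' (U e) x hx hx']
  -- A node shared by two hyperedges occurs on the whole path between them, so agreement of
  -- neighbours propagates along it.
  have walk : ∀ {e e'} (w : T.Walk e e') x, (∀ g ∈ w.support, x ∈ s g) →
      (U e).1 x = (U e').1 x := by
    intro e e' w x hw
    induction w with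
    | nil => rfl
    | cons h w ih =>
      rw [adj h x (hw _ (by simp)) (hw _ (by simp))]
      exact ih fun g hg => hw g (by simp [hg])
  have all : ∀ e e' x, x ∈ s e → x ∈ s e' → (U e).1 x = (U e').1 x := fun e e' x hx hx' =>
    walk (hT e e').some.toPath.1 x (hs e e' x hx hx' _ (hT e e').some.toPath.2)
  have hr : (U r).1 = f₀ := by
    have : p r = .nil := eq_of_isPath hT' (hp r) .nil
    simp only [hU, this, glueWalk, hg]
  -- By `all`, it does not matter which hyperedge containing `x` is chosen; `f₀` is only a default
  -- for points in no hyperedge.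
  refine ⟨fun x => if hx : ∃ e, x ∈ s e then (U hx.choose).1 x else f₀ x, fun e =>
    ⟨U e, (U e).2, fun x hx => ?_⟩, fun x hx => ?_⟩
  · have hx' : ∃ e, x ∈ s e := ⟨e, hx⟩
    simp only [hx', dite_true]
    exact all _ _ x hx'.choose_spec hx
  · have hx' : ∃ e, x ∈ s e := ⟨r, hx⟩
    simp only [hx', dite_true]
    rw [← hr]
    exact all _ _ x hx'.choose_spec hx

end Glue

/-! ## Solutions from consistent families of views -/

/-- `V` is a family of relations for the views of a `v`-structure for `A`, and the relations of the
base views are contained in the relations of `B`. -/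
structure IsFamily (A B : FinStr) (V : List Table) : Prop where
  isViewStructure : IsViewStructure A (V.map Prod.fst)
  hasArities : HasArities V
  base_subset : ∀ w ∈ V, ∀ R ∈ w.1.base, ∀ u ∈ w.2, u ∈ B.rel R

/-- The homomorphism `f` is in the join of the views. -/
def Carries (V : List Table) (f : Name → Name) : Prop := ∀ w ∈ V, w.1.scope.map f ∈ w.2

/-- The only value of `X` is `a`. -/
def Pinned (V : List Table) (X a : Name) : Prop := ∃ w ∈ V, w.1.scope = [X] ∧ ∀ u ∈ w.2, u = [a]

theorem map_fst_reviseRels (V W : List Table) :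
    (reviseRels V W).map Prod.fst = W.map Prod.fst := by
  simp [reviseRels]

theorem mem_reviseRels {V W : List Table} {w : Table} (h : w ∈ reviseRels V W) :
    ∃ w' ∈ W, w.1 = w'.1 ∧ ∀ u ∈ w.2, u ∈ w'.2 := by
  obtain ⟨w', hw', rfl⟩ := List.mem_map.1 h
  exact ⟨w', hw', rfl, fun u hu => List.mem_of_mem_filter hu⟩

/-! ### What revising the views and fixing a value preserve. -/

section

variable {A B : FinStr} {V : List Table}

theorem IsFamily.exists_base (h : IsFamily A B V) {R : Sym} {t : List Name} (ht : t ∈ A.rel R) :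
    ∃ w ∈ V, w.1.scope = t ∧ R ∈ w.1.base := by
  obtain ⟨v, hv, h₁, h₂⟩ := h.isViewStructure.2.2 R t ht
  obtain ⟨w, hw, rfl⟩ := List.mem_map.1 hv
  exact ⟨w, hw, h₁, h₂⟩

theorem IsFamily.scope_mem (h : IsFamily A B V) {w : Table} (hw : w ∈ V) {R : Sym}
    (hR : R ∈ w.1.base) : w.1.scope ∈ A.rel R :=
  h.isViewStructure.2.1 _ (List.mem_map_of_mem hw) R hR

theorem IsFamily.revise (h : IsFamily A B V) : IsFamily A B (reviseRels V V) where
  isViewStructure := by rw [map_fst_reviseRels]; exact h.isViewStructure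
  hasArities w hw u hu := by
    obtain ⟨w', hw', h₁, h₂⟩ := mem_reviseRels hw
    rw [h₁]
    exact h.hasArities w' hw' u (h₂ u hu)
  base_subset w hw R hR u hu := by
    obtain ⟨w', hw', h₁, h₂⟩ := mem_reviseRels hw
    exact h.base_subset w' hw' R (h₁ ▸ hR) u (h₂ u hu)

/-- The restrictions of one function `f` to the scopes agree with each other, so none of them is
deleted. -/
theorem Carries.revise {f : Name → Name} (h : Carries V f) : Carries (reviseRels V V) f := by
  intro w hw
  obtain ⟨w', hw', rfl⟩ := List.mem_map.1 hw
  refine List.mem_filter.2 ⟨h w' hw', List.all_eq_true.2 fun w'' hw'' => List.any_eq_true.2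
    ⟨_, h w'' hw'', agrees_map_iff.2 fun _ _ _ => rfl⟩⟩

theorem Pinned.revise {X a : Name} (h : Pinned V X a) : Pinned (reviseRels V V) X a := by
  obtain ⟨w, hw, h₁, h₂⟩ := h
  exact ⟨_, List.mem_map_of_mem hw, h₁, fun u hu => h₂ u (List.mem_of_mem_filter hu)⟩

/-- What is kept by a revision of all views is kept by the iterated revision. -/
theorem iterate_revise {P : List Table → Prop} (hP : ∀ V, P V → P (reviseRels V V)) (n : ℕ)
    (h : P V) : P ((fun V => reviseRels V V)^[n] V) :=
  Function.Iterate.rec P (f := fun V => reviseRels V V) h (fun V h => hP V h) n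

theorem exists_mem_domRel_eq {R : Sym} (h : ∃ w ∈ V, R ∈ w.1.base) :
    ∃ w ∈ V, R ∈ w.1.base ∧ domRel R V = w.2 := by
  induction V with
  | nil => simp at h
  | cons w V ih =>
    simp only [domRel]
    split_ifs with hR
    · exact ⟨w, List.mem_cons_self, hR, rfl⟩
    · obtain ⟨w', hw', h'⟩ := h
      rcases List.mem_cons.1 hw' with rfl | hw'
      · exact absurd h' hR
      · obtain ⟨w'', h₁, h₂⟩ := ih ⟨w', hw', h'⟩
        exact ⟨w'', List.mem_cons_of_mem _ h₁, h₂⟩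

theorem map_fst_fixRel (R : Sym) (a : Name) (V : List Table) :
    (fixRel R a V).map Prod.fst = V.map Prod.fst := by
  induction V with
  | nil => rfl
  | cons w V ih =>
    simp only [fixRel]
    split_ifs <;> simp [ih]

theorem mem_fixRel {R : Sym} {a : Name} {w : Table} (ha : [a] ∈ domRel R V)
    (h : w ∈ fixRel R a V) :
    w ∈ V ∨ ∃ w' ∈ V, R ∈ w'.1.base ∧ [a] ∈ w'.2 ∧ w = (w'.1, [[a]]) := by
  induction V with
  | nil => simp [fixRel] at h
  | cons w' V ih =>
    simp only [fixRel, domRel] at h ha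
    split_ifs at h ha with hR
    · rcases List.mem_cons.1 h with rfl | h
      · exact .inr ⟨w', List.mem_cons_self, hR, ha, rfl⟩
      · exact .inl (List.mem_cons_of_mem _ h)
    · rcases List.mem_cons.1 h with rfl | h
      · exact .inl List.mem_cons_self
      · rcases ih ha h with h | ⟨w'', h₁, h₂⟩
        · exact .inl (List.mem_cons_of_mem _ h)
        · exact .inr ⟨w'', List.mem_cons_of_mem _ h₁, h₂⟩

theorem mem_fixRel_of_mem {R : Sym} (a : Name) {w : Table} (h : w ∈ V) :
    w ∈ fixRel R a V ∨ R ∈ w.1.base ∧ (w.1, [[a]]) ∈ fixRel R a V := by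
  induction V with
  | nil => simp at h
  | cons w' V ih =>
    simp only [fixRel]
    split_ifs with hR
    · rcases List.mem_cons.1 h with rfl | h
      · exact .inr ⟨hR, List.mem_cons_self⟩
      · exact .inl (List.mem_cons_of_mem _ h)
    · rcases List.mem_cons.1 h with rfl | h
      · exact .inl List.mem_cons_self
      · exact (ih h).imp (List.mem_cons_of_mem _) (And.imp_right (List.mem_cons_of_mem _))

theorem exists_mem_fixRel {R : Sym} (a : Name) (h : ∃ w ∈ V, R ∈ w.1.base) :
    ∃ w ∈ V, R ∈ w.1.base ∧ (w.1, [[a]]) ∈ fixRel R a V := by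
  induction V with
  | nil => simp at h
  | cons w' V ih =>
    simp only [fixRel]
    split_ifs with hR
    · exact ⟨w', List.mem_cons_self, hR, List.mem_cons_self⟩
    · obtain ⟨w, hw, h'⟩ := h
      rcases List.mem_cons.1 hw with rfl | hw
      · exact absurd h' hR
      · obtain ⟨w'', h₁, h₂, h₃⟩ := ih ⟨w, hw, h'⟩
        exact ⟨w'', List.mem_cons_of_mem _ h₁, h₂, List.mem_cons_of_mem _ h₃⟩

/-- The relation that is replaced contains `[a]`, so it is at least as large as `{⟨a⟩}`. Hence the
size of the family never increases in the recursion. -/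
theorem size_fixRel_le_of_mem {R : Sym} {a : Name} (ha : [a] ∈ domRel R V) :
    (encList Table.enc (fixRel R a V)).size ≤ (encList Table.enc V).size := by
  induction V with
  | nil => simp [fixRel]
  | cons w V ih =>
    simp only [fixRel, domRel] at ha ⊢
    split_ifs at ha ⊢ with hR
    · have := size_lt_of_mem_encList Data.ofList ha
      simp [Table.enc, encRel] at this ⊢
      omega
    · have := ih ha
      simp
      omega

variable {X a : Name}

/-- The base view of a domain constraint. -/
theorem IsFamily.exists_dom (h : IsFamily A B V) (hA : A.IsLeft) (hX : Sym.dom X ∈ A.voc) :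
    ∃ w ∈ V, w.1.scope = [X] ∧ Sym.dom X ∈ w.1.base :=
  h.exists_base (by rw [hA.2 X hX]; rfl)

theorem IsFamily.scope_eq (h : IsFamily A B V) (hA : A.IsLeft) (hX : Sym.dom X ∈ A.voc) {w : Table}
    (hw : w ∈ V) (hb : Sym.dom X ∈ w.1.base) : w.1.scope = [X] := by
  have := h.scope_mem hw hb
  rwa [hA.2 X hX] at this

theorem IsFamily.exists_domRel_eq (h : IsFamily A B V) (hA : A.IsLeft) (hX : Sym.dom X ∈ A.voc) :
    ∃ w ∈ V, w.1.scope = [X] ∧ domRel (.dom X) V = w.2 := by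
  obtain ⟨w, hw, -, hb⟩ := h.exists_dom hA hX
  obtain ⟨w', hw', hb', h'⟩ := exists_mem_domRel_eq ⟨w, hw, hb⟩
  exact ⟨w', hw', h.scope_eq hA hX hw' hb', h'⟩

/-- The new tuple `[a]` was already in the relation, so arities and inclusions in the relations of
`B` persist. -/
theorem IsFamily.fix (h : IsFamily A B V) (ha : [a] ∈ domRel (.dom X) V) :
    IsFamily A B (fixRel (.dom X) a V) where
  isViewStructure := by rw [map_fst_fixRel]; exact h.isViewStructure
  hasArities w hw u hu := by
    rcases mem_fixRel ha hw with hw | ⟨w', hw', -, ha', rfl⟩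
    · exact h.hasArities w hw u hu
    · obtain rfl := List.mem_singleton.1 hu
      exact h.hasArities w' hw' _ ha'
  base_subset w hw R hR u hu := by
    rcases mem_fixRel ha hw with hw | ⟨w', hw', -, ha', rfl⟩
    · exact h.base_subset w hw R hR u hu
    · obtain rfl := List.mem_singleton.1 hu
      exact h.base_subset w' hw' R hR _ ha'

theorem Carries.fix (h : IsFamily A B V) (hA : A.IsLeft) (hX : Sym.dom X ∈ A.voc)
    (ha : [a] ∈ domRel (.dom X) V) {f : Name → Name} (hf : Carries V f) (hfX : f X = a) :
    Carries (fixRel (.dom X) a V) f := by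
  intro w hw
  rcases mem_fixRel ha hw with hw | ⟨w', hw', hb, -, rfl⟩
  · exact hf w hw
  · simp [h.scope_eq hA hX hw' hb, hfX]

/-- The view that changes is a base view for `dom X` and has the scope `[X]`, so it is not the view
that pins `Y`. -/
theorem Pinned.fix (h : IsFamily A B V) (hA : A.IsLeft) (hX : Sym.dom X ∈ A.voc) {Y b : Name}
    (hY : Y ≠ X) (hp : Pinned V Y b) : Pinned (fixRel (.dom X) a V) Y b := by
  obtain ⟨w, hw, h₁, h₂⟩ := hp
  rcases mem_fixRel_of_mem (R := .dom X) a hw with hw' | ⟨hb, -⟩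
  · exact ⟨w, hw', h₁, h₂⟩
  · rw [h.scope_eq hA hX hw hb] at h₁
    exact absurd (List.cons.inj h₁).1.symm hY

theorem pinned_fix (h : IsFamily A B V) (hA : A.IsLeft) (hX : Sym.dom X ∈ A.voc) :
    Pinned (fixRel (.dom X) a V) X a := by
  obtain ⟨w, hw, -, hb⟩ := h.exists_dom hA hX
  obtain ⟨w', hw', hb', h'⟩ := exists_mem_fixRel a ⟨w, hw, hb⟩
  have hs := h.scope_eq hA hX hw' hb'
  exact ⟨_, h', hs, by simp⟩

theorem IsLegal.isFamily {W : List (List (List Name))} {V : List View}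
    (h : IsLegal A B V W) (hV : IsViewStructure A V) : IsFamily A B (V.zip W) where
  isViewStructure := by
    rw [List.map_fst_zip h.1.le]
    exact hV
  hasArities w hw := (h.2 w hw).1
  base_subset w hw := (h.2 w hw).2.2

theorem IsLegal.carries {W : List (List (List Name))} {V : List View} (h : IsLegal A B V W)
    {f : Name → Name} (hf : Str.IsHom f A.toStr B.toStr) : Carries (V.zip W) f :=
  fun w hw => (h.2 w hw).2.1 _ ⟨f, hf, rfl⟩

end

/-! ### From consistency and a tree projection to homomorphisms. -/

section

variable {A B A' B' : FinStr} {V : List Table} {O : List Name}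

/-- A function that is in the relation of some view on each hyperedge of a tree projection gives a
homomorphism. -/
theorem exists_hom_of_glued (hI : IsInstance A B) (hr : IsRestriction A B O A' B')
    (hV : IsFamily A' B' V) (hc : IsConsistent V)
    {C : Str (Sym ⊕ Name)} (hC : C.IsCore (A.toStr.union (Str.singletons O)))
    {H : Hypergraph} (hCH : C.hypergraph.Le H) (s : H.edges → Table) (hsV : ∀ e, s e ∈ V)
    (hs : ∀ e, ∀ x ∈ e.1, x ∈ (s e).1.scope) (h : Name → Name)
    (hh : ∀ e, ∃ f, (s e).1.scope.map f ∈ (s e).2 ∧ ∀ x ∈ e.1, h x = f x) :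
    ∃ f, Str.IsHom f A.toStr B.toStr ∧ (∀ X ∈ O, f X = h X) ∧
      ∀ X ∈ O, ∀ w ∈ V, w.1.scope = [X] → [h X] ∈ w.2 := by
  obtain ⟨⟨-, hCA, -⟩, ⟨g, hg₁, hg₂⟩, -⟩ := hC
  -- The tuple `t` of the core lies in a hyperedge `e`, on which `h` agrees with a tuple of the view
  -- `s e`. Consistency carries that tuple over to `w`, and the scope of `w` consists of common
  -- variables only.
  have cover : ∀ R, ∀ t ∈ C.rel R, ∀ w ∈ V, w.1.scope = t → t.map h ∈ w.2 := by
    intro R t ht w hw hwt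
    obtain ⟨e, he, hte⟩ := hCH {x | x ∈ t} ⟨R, t, ht, rfl⟩
    obtain ⟨f, hf, hf'⟩ := hh ⟨e, he⟩
    obtain ⟨f', h₁, h₂⟩ := hc.exists_agree hV.hasArities (hsV ⟨e, he⟩) hw hf
    rw [hwt] at h₁ h₂
    convert h₁ using 1
    refine List.map_congr_left fun x hx => ?_
    rw [hf' x (hte hx), h₂ x (hs ⟨e, he⟩ x (hte hx)) hx]
  -- The private unary symbol of `X` holds only of `X`, so it forces the map to the core to fix `X`
  -- and the tuple `[X]` to survive in the core.
  have gO : ∀ X ∈ O, g X = X ∧ [X] ∈ C.rel (.inr X) := by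
    intro X hX
    have h₁ : [g X] ∈ C.rel (.inr X) := hg₂ (.inr X) [X] ⟨hX, rfl⟩
    obtain ⟨-, h₂⟩ : X ∈ O ∧ [g X] = [X] := hCA (.inr X) h₁
    have h₃ := (List.cons.inj h₂).1
    rw [h₃] at h₁
    exact ⟨h₃, h₁⟩
  have hom : ∀ R : Sym, ∀ t ∈ C.rel (.inl R), t.map h ∈ B.rel R := by
    intro R t ht
    have htA : t ∈ A.rel R := hCA (.inl R) ht
    obtain ⟨w, hw, hwt, hb⟩ := hV.exists_base (hr.rel_subset R htA)
    exact hr.rel_subset_right R (FinStr.mem_voc_of_mem_rel htA)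
      (hV.base_subset w hw R hb _ (cover _ t ht w hw hwt))
  have dom : ∀ X ∈ O, ∀ w ∈ V, w.1.scope = [X] → [h X] ∈ w.2 :=
    fun X hX w hw hwX => cover _ _ (gO X hX).2 w hw hwX
  have univ : ∀ X ∈ O, h X ∈ B.univ := by
    intro X hX
    obtain ⟨w, hw, hwX, hb⟩ := hV.exists_dom hr.isInstance.1 (hr.dom_mem X hX)
    rw [← hr.univ_eq]
    exact hr.isInstance.2.1.2.2 _ _ (hV.base_subset w hw _ hb _ (dom X hX w hw hwX)) _
      List.mem_cons_self
  obtain ⟨b, hb⟩ := List.exists_mem_of_ne_nil _ hI.2.2.1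
  classical
  -- The homomorphism is `h ∘ g`. A variable in no tuple may have its value outside the universe of
  -- `B`, and is then sent to `b`; for entries of tuples and for output variables the default is
  -- never taken.
  refine ⟨fun x => if h (g x) ∈ B.univ then h (g x) else b, ⟨fun x _ => ?_, fun R t ht => ?_⟩,
    fun X hX => ?_, dom⟩
  · show _ ∈ B.univ
    beta_reduce
    split_ifs with hx
    · exact hx
    · exact hb
  · have h₁ : (t.map g).map h ∈ B.rel R := hom R _ (hg₂ (.inl R) t ht)
    show _ ∈ B.rel R
    convert h₁ using 1
    rw [List.map_map]
    refine List.map_congr_left fun x hx => if_pos ?_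
    exact hI.2.1.2.2 R _ h₁ _ (List.mem_map_of_mem (List.mem_map_of_mem hx))
  · beta_reduce
    rw [(gO X hX).1, if_pos (univ X hX)]

/-- If the relations of a consistent family of views, which covers `(A, O)`, are not empty, then
there is a solution, and each value of an output variable belongs to a solution. -/
theorem exists_hom_of_isConsistent (hI : IsInstance A B) (hr : IsRestriction A B O A' B')
    (hV : IsFamily A' B' V) (hc : IsConsistent V) (htp : TpCovered A O (V.map Prod.fst))
    (hne : ∀ w ∈ V, w.2 ≠ []) :
    (∃ f, Str.IsHom f A.toStr B.toStr ∧ ∀ Y ∈ O, ∀ w ∈ V, w.1.scope = [Y] → [f Y] ∈ w.2) ∧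
    ∀ X ∈ O, ∀ w ∈ V, w.1.scope = [X] → ∀ a, [a] ∈ w.2 → ∃ f, Str.IsHom f A.toStr B.toStr ∧
      f X = a ∧ ∀ Y ∈ O, ∀ w ∈ V, w.1.scope = [Y] → [f Y] ∈ w.2 := by
  obtain ⟨C, hC, H, ⟨T, hT₁, hT₂, hT₃⟩, hCH, hHV⟩ := htp
  have hs : ∀ e : H.edges, ∃ w ∈ V, ∀ x ∈ e.1, x ∈ w.1.scope := by
    rintro ⟨e, he⟩
    obtain ⟨_, ⟨v, hv, rfl⟩, hev⟩ := hHV e he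
    obtain ⟨w, hw, rfl⟩ := List.mem_map.1 hv
    exact ⟨w, hw, hev⟩
  choose s hsV hs using hs
  have hstep : ∀ (e e' : H.edges) f, (s e).1.scope.map f ∈ (s e).2 →
      ∃ f', (s e').1.scope.map f' ∈ (s e').2 ∧ ∀ x ∈ e.1, x ∈ e'.1 → f x = f' x := by
    intro e e' f hf
    obtain ⟨f', h₁, h₂⟩ := hc.exists_agree hV.hasArities (hsV e) (hsV e') hf
    exact ⟨f', h₁, fun x hx hx' => h₂ x (hs e x hx) (hs e' x hx')⟩
  have glue := fun r f₀ => exists_glue (P := fun e f => (s e).1.scope.map f ∈ (s e).2) hT₁ hT₂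
    (fun e => e.1) hT₃ hstep r f₀
  constructor
  · obtain ⟨h, hh⟩ : ∃ h : Name → Name, ∀ e, ∃ f, (s e).1.scope.map f ∈ (s e).2 ∧
        ∀ x ∈ e.1, h x = f x := by
      rcases isEmpty_or_nonempty H.edges with hE | ⟨⟨r⟩⟩
      -- Without hyperedges there is no tuple to respect, and any function will do.
      · exact ⟨id, fun e => (hE.false e).elim⟩
      · obtain ⟨u, hu⟩ := List.exists_mem_of_ne_nil _ (hne _ (hsV r))
        obtain ⟨f₀, rfl⟩ := hc.exists_map hV.hasArities (hsV r) hu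
        obtain ⟨h, hh, -⟩ := glue r f₀ hu
        exact ⟨h, hh⟩
    obtain ⟨f, h₁, h₂, h₃⟩ := exists_hom_of_glued hI hr hV hc hC hCH s hsV hs h hh
    exact ⟨f, h₁, fun Y hY w hw hwY => by rw [h₂ Y hY]; exact h₃ Y hY w hw hwY⟩
  · intro X hX w hw hwX a ha
    have hXC : ∃ e ∈ H.edges, X ∈ e := by
      obtain ⟨⟨-, hCA, -⟩, ⟨g, -, hg⟩, -⟩ := hC
      have h₁ : [g X] ∈ C.rel (.inr X) := hg (.inr X) [X] ⟨hX, rfl⟩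
      obtain ⟨-, h₂⟩ : X ∈ O ∧ [g X] = [X] := hCA (.inr X) h₁
      rw [h₂] at h₁
      obtain ⟨e, he, hte⟩ := hCH {x | x ∈ [X]} ⟨_, _, h₁, rfl⟩
      exact ⟨e, he, hte (List.mem_singleton.2 rfl)⟩
    obtain ⟨e, he, hXe⟩ := hXC
    -- The tree is rooted at a hyperedge that contains `X`. Consistency between the view with scope
    -- `[X]` and the view at the root gives a root function with the value `a` at `X`, and the
    -- gluing keeps it.
    obtain ⟨f₀, hf₀, hag⟩ := hc.exists_agree hV.hasArities hw (hsV ⟨e, he⟩) (f := fun _ => a)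
      (by simpa [hwX] using ha)
    obtain ⟨h, hh, hh'⟩ := glue ⟨e, he⟩ f₀ hf₀
    obtain ⟨f, h₁, h₂, h₃⟩ := exists_hom_of_glued hI hr hV hc hC hCH s hsV hs h hh
    refine ⟨f, h₁, ?_, fun Y hY w hw hwY => by rw [h₂ Y hY]; exact h₃ Y hY w hw hwY⟩
    rw [h₂ X hX, hh' X hXe, ← hag X (by simp [hwX]) (hs ⟨e, he⟩ X hXe)]

/-- In a consistent family of views, all relations are empty or none. -/
theorem IsConsistent.ne_nil (hc : IsConsistent V) {w : Table} (hw : w ∈ V) (hne : w.2 ≠ [])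
    {w' : Table} (hw' : w' ∈ V) : w'.2 ≠ [] := by
  obtain ⟨u, hu⟩ := List.exists_mem_of_ne_nil _ hne
  obtain ⟨u', hu', -⟩ := hc.supportedAll hw hu hw'
  exact List.ne_nil_of_mem hu'

end

/-! ## Runs with output -/

attribute [simp] ticks_append

@[simp] theorem ticks_append_ticks_append (k m : ℕ) (t : Trace) :
    ticks k ++ (ticks m ++ t) = ticks (k + m) ++ t := by
  rw [← List.append_assoc, ticks_append]

/-- The weakest precondition for an evaluation of `e` to a value `v` with a history `t` such that
`Q v t`. -/
def traced {F : Type} (code : F → Exp F) : (ℕ → Data) → Exp F → (Data → Trace → Prop) → Prop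
  | env, .var x, Q => Q (env x) (ticks (env x).size)
  | _, .nil, Q => Q .nil (ticks 1)
  | env, .cons a b, Q => traced code env a fun u s => traced code env b fun v t =>
      Q (.cons u v) (s ++ t ++ ticks (1 + u.size + v.size))
  | env, .eq a b, Q => traced code env a fun u s => traced code env b fun v t =>
      Q (Data.ofProp (u = v)) (s ++ t ++ ticks 1)
  | env, .ite c a b, Q => traced code env c fun u s =>
      u.elim (traced code env b fun v t => Q v (s ++ ticks 1 ++ t))
        fun _ _ => traced code env a fun v t => Q v (s ++ ticks 1 ++ t)
  | env, .letE x e b, Q => traced code env e fun u s =>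
      traced code (Function.update env x u) b fun v t => Q v (s ++ ticks 1 ++ t)
  | env, .caseE e n x y c, Q => traced code env e fun u s =>
      u.elim (traced code env n fun v t => Q v (s ++ ticks 1 ++ t))
        fun a b => traced code (Function.update (Function.update env x a) y b) c
          fun v t => Q v (s ++ ticks 1 ++ t)
  | env, .call f e, Q => traced code env e fun u s =>
      ∃ v t, Run code f u v t ∧ Q v (s ++ ticks 1 ++ t)
  | env, .emit e, Q => traced code env e fun u s => Q .nil (s ++ some u :: ticks 1)

attribute [simp] traced

theorem exists_eval_of_traced {F : Type} {code : F → Exp F} {env : ℕ → Data} {e : Exp F}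
    {Q : Data → Trace → Prop} (h : traced code env e Q) :
    ∃ v t, Eval code env e v t ∧ Q v t := by
  induction e generalizing env Q with
  | var x => exact ⟨_, _, .var _ _, h⟩
  | nil => exact ⟨_, _, .nil _, h⟩
  | cons a b iha ihb =>
    obtain ⟨u, s, hu, h⟩ := iha h
    obtain ⟨v, t, hv, h⟩ := ihb h
    exact ⟨_, _, hu.cons hv, h⟩
  | eq a b iha ihb =>
    obtain ⟨u, s, hu, h⟩ := iha h
    obtain ⟨v, t, hv, h⟩ := ihb h
    exact ⟨_, _, hu.eq hv, h⟩
  | ite c a b ihc iha ihb =>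
    obtain ⟨u, s, hu, h⟩ := ihc h
    cases u with
    | nil =>
      obtain ⟨v, t, hv, h⟩ := ihb h
      exact ⟨_, _, hu.ite_false hv, h⟩
    | cons =>
      obtain ⟨v, t, hv, h⟩ := iha h
      exact ⟨_, _, hu.ite_true hv, h⟩
  | letE x e b ihe ihb =>
    obtain ⟨u, s, hu, h⟩ := ihe h
    obtain ⟨v, t, hv, h⟩ := ihb h
    exact ⟨_, _, hu.letE hv, h⟩
  | caseE e n x y c ihe ihn ihc =>
    obtain ⟨u, s, hu, h⟩ := ihe h
    cases u with
    | nil =>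
      obtain ⟨v, t, hv, h⟩ := ihn h
      exact ⟨_, _, hu.case_nil hv, h⟩
    | cons =>
      obtain ⟨v, t, hv, h⟩ := ihc h
      exact ⟨_, _, hu.case_cons hv, h⟩
  | call f e ihe =>
    obtain ⟨u, s, hu, v, t, hv, h⟩ := ihe h
    exact ⟨_, _, hu.call hv, h⟩
  | emit e ihe =>
    obtain ⟨u, s, hu, h⟩ := ihe h
    exact ⟨_, _, hu.emit, h⟩

/-- The history `t`, started after `c` silent units of time, has no silent stretch of more than `T`
units of time, and ends with a silent stretch of at most `b` units of time. -/
def Paced (T b : ℕ) : ℕ → Trace → Prop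
  | c, [] => c ≤ b ∧ c ≤ T
  | c, none :: t => Paced T b (c + 1) t
  | c, some _ :: t => c ≤ T ∧ Paced T b 0 t

theorem Paced.mono {T b b' c c' : ℕ} {t : Trace} (h : Paced T b c t) (hc : c' ≤ c) (hb : b ≤ b') :
    Paced T b' c' t := by
  induction t generalizing c c' with
  | nil => exact ⟨hc.trans (h.1.trans hb), hc.trans h.2⟩
  | cons o t ih =>
    cases o with
    | none => exact ih (c := c + 1) h (by omega)
    | some d => exact ⟨hc.trans h.1, ih h.2 le_rfl⟩

theorem Paced.append {T a b c : ℕ} {s t : Trace} (hs : Paced T a c s) (ht : Paced T b a t) :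
    Paced T b c (s ++ t) := by
  induction s generalizing c with
  | nil => exact ht.mono hs.1 le_rfl
  | cons o s ih =>
    cases o with
    | none => exact ih (c := c + 1) hs
    | some d => exact ⟨hs.1, ih hs.2⟩

theorem paced_ticks {T b c k : ℕ} (hb : c + k ≤ b) (hT : c + k ≤ T) : Paced T b c (ticks k) := by
  induction k generalizing c with
  | zero => exact ⟨hb, hT⟩
  | succ k ih => exact ih (c := c + 1) (by omega) (by omega)

theorem Paced.of_append_right {T b c : ℕ} {s t : Trace} (h : Paced T b c (s ++ t)) :
    ∃ c', Paced T b c' t := by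
  induction s generalizing c with
  | nil => exact ⟨c, h⟩
  | cons o s ih =>
    cases o with
    | none => exact ih (c := c + 1) h
    | some d => exact ih h.2

/-- The counter `c` adds up the silent time since the last output, and is compared with `T` at the
next output or at the end of the history. -/
theorem Paced.length_le {T b c : ℕ} {s t : Trace} (h : Paced T b c (s ++ t))
    (hs : ∀ o ∈ s, o = none) : c + s.length ≤ T := by
  induction s generalizing c with
  | nil =>
    induction t generalizing c with
    | nil => exact h.2
    | cons o t ih =>
      cases o with
      | none =>
        have := ih (c := c + 1) h
        simp at this ⊢
        omega
      | some d => exact h.1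
  | cons o s ih =>
    obtain rfl := hs o List.mem_cons_self
    have := ih (c := c + 1) h fun o ho => hs o (List.mem_cons_of_mem _ ho)
    simp only [List.length_cons]
    omega

/-- The outputs in the history `t` are the elements of `S`, each one exactly once; if `t` is started
at most `T - a` silent units of time after the last output, all silent stretches have at most `T`
units of time, and the last one has at most `b`. -/
def Enumerates (T a b : ℕ) (t : Trace) (S : Set (List Data)) : Prop :=
  ∃ L : List (List Data), t.filterMap id = L.map Data.ofList ∧ L.Nodup ∧ (∀ q, q ∈ L ↔ q ∈ S) ∧
    ∀ c, c + a ≤ T → Paced T b c t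

theorem filterMap_ticks (k : ℕ) : (ticks k).filterMap id = [] := by
  induction k with
  | zero => rfl
  | succ k ih => exact ih

theorem enumerates_single {T a b : ℕ} (q : List Data) :
    Enumerates T a b [some (Data.ofList q)] {q} :=
  ⟨[q], rfl, by simp, by simp, fun c hc => ⟨by omega, by simp, by simp⟩⟩

theorem enumerates_ticks {T a b k : ℕ} (ha : k ≤ a) (hb : T + k ≤ b + a) :
    Enumerates T a b (ticks k) ∅ :=
  ⟨[], filterMap_ticks k, by simp, by simp, fun c hc => paced_ticks (by omega) (by omega)⟩

theorem Enumerates.ticks_append {T a a' b k : ℕ} {t : Trace} {S : Set (List Data)}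
    (h : Enumerates T a b t S) (hk : a + k ≤ a') : Enumerates T a' b (ticks k ++ t) S := by
  obtain ⟨L, h₁, h₂, h₃, h₄⟩ := h
  refine ⟨L, by rw [List.filterMap_append, filterMap_ticks, h₁]; rfl, h₂, h₃, fun c hc => ?_⟩
  exact (paced_ticks (b := c + k) le_rfl (by omega)).append (h₄ _ (by omega))

/-- The stretch across the seam is at most the silent end `b` of the first run plus the time `b'`
that the second reserves before its first output. -/
theorem Enumerates.append {T a b b' c : ℕ} {s t : Trace} {S S' : Set (List Data)}
    (hs : Enumerates T a b s S) (ht : Enumerates T b' c t S') (hb : b + b' ≤ T)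
    (hd : Disjoint S S') : Enumerates T a c (s ++ t) (S ∪ S') := by
  obtain ⟨L, h₁, h₂, h₃, h₄⟩ := hs
  obtain ⟨L', h₁', h₂', h₃', h₄'⟩ := ht
  refine ⟨L ++ L', by rw [List.filterMap_append, h₁, h₁', List.map_append], ?_, by simp [h₃, h₃'], fun d hd =>
    (h₄ d hd).append (h₄' b hb)⟩
  exact List.nodup_append.2 ⟨h₂, h₂', fun q hq q' hq' h => Set.disjoint_left.1 hd ((h₃ q).1 hq)
    ((h₃' q).1 (h ▸ hq'))⟩

theorem Enumerates.mono {T a a' b b' : ℕ} {t : Trace} {S : Set (List Data)}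
    (h : Enumerates T a b t S) (ha : a ≤ a') (hb : b ≤ b') : Enumerates T a' b' t S := by
  obtain ⟨L, h₁, h₂, h₃, h₄⟩ := h
  exact ⟨L, h₁, h₂, h₃, fun c hc => (h₄ c (by omega)).mono le_rfl hb⟩

/-- Between two outputs of an enumeration, there is nothing but a short silent stretch. -/
theorem Enumerates.append_ticks {T a b b' k : ℕ} {t : Trace} {S : Set (List Data)}
    (h : Enumerates T a b t S) (hb : b + k ≤ b') (hT : b + k ≤ T) :
    Enumerates T a b' (t ++ ticks k) S := by
  obtain ⟨L, h₁, h₂, h₃, h₄⟩ := h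
  exact ⟨L, by rw [List.filterMap_append, filterMap_ticks, h₁, List.append_nil], h₂, h₃, fun c hc =>
    (h₄ c hc).append (paced_ticks hb hT)⟩

/-- An enumeration followed by a short silent stretch or by another enumeration. -/
theorem Enumerates.cons {T J H k m : ℕ} {s t : Trace} {S S' : Set (List Data)}
    (hs : Enumerates T J J s S) (hT : 2 * J + 4 * H ≤ T) (hk : k ≤ H) (hm : m ≤ H)
    (ht : (∃ n ≤ H, t = ticks n ∧ S' = ∅) ∨ Enumerates T (J + H) (J + 2 * H) t S')
    (hd : Disjoint S S') :
    Enumerates T (J + H) (J + 2 * H) (ticks k ++ (s ++ (ticks m ++ t))) (S ∪ S') := by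
  rcases ht with ⟨n, hn, rfl, rfl⟩ | ht
  · rw [Set.union_empty, ECSP.ticks_append]
    exact (hs.append_ticks (by omega) (by omega)).ticks_append (by omega)
  · exact (hs.append (ht.ticks_append (a' := J + 2 * H) (by omega)) (by omega) hd).ticks_append
      (by omega)

theorem Enumerates.enumeratesWithDelay {F : Type} {code : F → Exp F} {f : F} {d v : Data}
    {t : Trace} {S : Set (List Data)} {T a b : ℕ} (h : Enumerates T a b t S) (ha : a ≤ T)
    (hr : Run code f d v t) : EnumeratesWithDelay code f d S T := by
  obtain ⟨L, h₁, h₂, h₃, h₄⟩ := h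
  refine ⟨v, t, L, hr, h₁, h₂, h₃, ?_⟩
  rintro t₁ t₂ t₃ rfl ht₂
  have h₅ := h₄ 0 (by omega)
  rw [List.append_assoc] at h₅
  obtain ⟨c, hc⟩ := h₅.of_append_right
  have := hc.length_le ht₂
  omega

/-! ### The loop over the values of one variable. -/

section

variable (dm : DecompositionMethod)

theorem run_of_traced {F : Type} {code : F → Exp F} {f : F} {d : Data} {Q : Trace → Prop}
    (h : traced code (Function.update (fun _ => Data.nil) 0 d) (code f) fun _ t => Q t) :
    ∃ v t, Run code f d v t ∧ Q t := exists_eval_of_traced h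

/-- The run of `forEach`: `S a` are the outputs for the value `a`. -/
theorem run_forEach {T J H N : ℕ} (hH : 60 * (N + 1) + 3 * cst 7 N ≤ H) (hT : 2 * J + 4 * H ≤ T)
    (X : Name) (O : List Name) (V : List Table) (p : List Name) (S : Name → Set (List Name))
    (as : List Name) (has : as.Nodup)
    (h₀ : O = [] → ∀ a ∈ as, S a = {p ++ [a]})
    (h₁ : O ≠ [] → ∀ a ∈ as, ∃ v t, Run (computeAllSolutions dm) (.inr .propagate)
      (.cons (Data.ofList O) (.cons (encList Table.enc (fixRel (.dom X) a V))
        (Data.ofList (p ++ [a])))) v t ∧ Enumerates T J J t (S a))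
    (hd : ∀ a ∈ as, ∀ b ∈ as, a ≠ b → Disjoint (S a) (S b))
    (hN : (Data.ofList as).size + X.size + (Data.ofList O).size + (encList Table.enc V).size +
      (Data.ofList p).size + 10 < N) :
    ∃ v t, Run (computeAllSolutions dm) (.inr .forEach)
      (.cons (Data.ofList as) (.cons X (.cons (Data.ofList O) (.cons (encList Table.enc V)
        (Data.ofList p))))) v t ∧
      (as = [] ∧ (∃ k ≤ H, t = ticks k) ∨
        as ≠ [] ∧ Enumerates T (J + H) (J + 2 * H) t {q | ∃ a ∈ as, q ∈ S a}) := by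
  induction as with
  | nil =>
    apply run_of_traced
    simp
    refine ⟨_, ?_, rfl⟩
    simp at hN
    omega
  | cons a as ih =>
    rw [List.nodup_cons] at has
    simp only [Data.ofList_cons, Data.size_cons] at hN
    obtain ⟨v, t, hr, ht⟩ := ih has.2 (fun h b hb => h₀ h b (List.mem_cons_of_mem _ hb))
      (fun h b hb => h₁ h b (List.mem_cons_of_mem _ hb)) (fun b hb c hc =>
        hd b (List.mem_cons_of_mem _ hb) c (List.mem_cons_of_mem _ hc)) (by omega)
    have c₂ : 3 * cst 1 N + 60 * (N + 1) ≤ cst 2 N := cst_le_succ 1 N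
    have c₃ : 3 * cst 2 N + 60 * (N + 1) ≤ cst 3 N := cst_le_succ 2 N
    have c₄ : 3 * cst 3 N + 60 * (N + 1) ≤ cst 4 N := cst_le_succ 3 N
    have c₅ : 3 * cst 4 N + 60 * (N + 1) ≤ cst 5 N := cst_le_succ 4 N
    have c₆ : 3 * cst 5 N + 60 * (N + 1) ≤ cst 6 N := cst_le_succ 5 N
    have c₇ : 3 * cst 6 N + 60 * (N + 1) ≤ cst 7 N := cst_le_succ 6 N
    have ht' : (∃ n ≤ H, t = ticks n ∧ {q | ∃ b ∈ as, q ∈ S b} = ∅) ∨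
        Enumerates T (J + H) (J + 2 * H) t {q | ∃ b ∈ as, q ∈ S b} := by
      rcases ht with ⟨rfl, k, hk, rfl⟩ | ⟨-, ht⟩
      · exact .inl ⟨k, hk, rfl, by simp⟩
      · exact .inr ht
    have hS : {q | ∃ b ∈ a :: as, q ∈ S b} = S a ∪ {q | ∃ b ∈ as, q ∈ S b} := by
      ext q; simp
    have hdis : Disjoint (S a) {q | ∃ b ∈ as, q ∈ S b} := by
      rw [Set.disjoint_right]
      rintro q ⟨b, hb, hq⟩ hq'
      refine Set.disjoint_left.1 (hd a List.mem_cons_self b (List.mem_cons_of_mem _ hb) ?_) hq' hq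
      rintro rfl
      exact has.1 hb
    obtain ⟨k, hk, hsnoc⟩ := computes_snoc dm (N := N) p a (by omega)
    have hsize := Data.size_ofList_append p [a]
    simp at hsize
    rw [hS]
    apply run_of_traced
    cases O with
    | nil =>
      have hb : Enumerates T J J [some (Data.ofList (p ++ [a]))] (S a) := by
        rw [h₀ rfl a List.mem_cons_self]
        exact enumerates_single _
      simp at hr hN ⊢
      refine ⟨_, _, hsnoc, _, _, hr, ?_⟩
      -- The silent times `k` before the output of the body and `m` after it stay open; they are
      -- read off from the computed history.
      have := fun k m hk hm => hb.cons (k := k) (m := m) hT hk hm ht' hdis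
      simp at this ⊢
      exact this _ _ (by omega) (by omega)
    | cons Y O =>
      obtain ⟨v', t', hr', hb⟩ := h₁ (by simp) a List.mem_cons_self
      obtain ⟨k', hk', hfix⟩ := computes_fixDom dm (N := N) (.dom X) a V
        (by simp [encSym] at hN ⊢; omega)
      have hsize' := size_fixRel_le (.dom X) a V
      simp [encSym] at hr hr' hN hfix ⊢
      refine ⟨_, _, hsnoc, _, _, hfix, _, _, hr', _, _, hr, ?_⟩
      have := fun k m hk hm => hb.cons (k := k) (m := m) hT hk hm ht' hdis
      simp at this ⊢
      exact this _ _ (by omega) (by omega)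

end

/-! ### The recursion over the output variables. -/

section

variable (dm : DecompositionMethod) {A B A' B' : FinStr} {O : List Name} {views : List View}

/-- What holds for the views and relations `V` when the variables `P` have been fixed to `p`. -/
structure IsState (A B A' B' : FinStr) (views : List View) (P p : List Name) (V : List Table) :
    Prop where
  isFamily : IsFamily A' B' V
  map_fst : V.map Prod.fst = views
  length_eq : P.length = p.length
  carries : ∀ f, Str.IsHom f A.toStr B.toStr → P.map f = p → Carries V f
  pinned : ∀ q ∈ P.zip p, Pinned V q.1 q.2

/-- The solutions with the values `p` for the variables `P`. -/
def extensions (A B : FinStr) (O P p : List Name) : Set (List Name) :=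
  {q | ∃ f, Str.IsHom f A.toStr B.toStr ∧ q = O.map f ∧ P.map f = p}

variable {P p : List Name} {V : List Table}

theorem IsState.revise (h : IsState A B A' B' views P p V) :
    IsState A B A' B' views P p (reviseRels V V) where
  isFamily := h.isFamily.revise
  map_fst := by rw [map_fst_reviseRels, h.map_fst]
  length_eq := h.length_eq
  carries f hf hP := (h.carries f hf hP).revise
  pinned q hq := (h.pinned q hq).revise

/-- Only the homomorphisms with the value `a` at `X` have to be carried on; `X ∉ P` keeps the
earlier pins intact. -/
theorem IsState.fix (h : IsState A B A' B' views P p V) (hA : A'.IsLeft) {X a : Name}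
    (hX : Sym.dom X ∈ A'.voc) (hXP : X ∉ P) (ha : [a] ∈ domRel (.dom X) V) :
    IsState A B A' B' views (P ++ [X]) (p ++ [a]) (fixRel (.dom X) a V) where
  isFamily := h.isFamily.fix ha
  map_fst := by rw [map_fst_fixRel, h.map_fst]
  length_eq := by simp [h.length_eq]
  carries f hf hP := by
    rw [List.map_append] at hP
    obtain ⟨h₁, h₂⟩ := List.append_inj hP (by simp [h.length_eq])
    exact (h.carries f hf h₁).fix h.isFamily hA hX ha (by simpa using h₂)
  pinned q hq := by
    rw [List.zip_append h.length_eq, List.mem_append] at hq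
    rcases hq with hq | hq
    · refine (h.pinned q hq).fix h.isFamily hA hX ?_
      rintro rfl
      exact hXP (List.of_mem_zip (a := q.1) (b := q.2) hq).1
    · obtain rfl : q = (X, a) := by simpa using hq
      exact pinned_fix h.isFamily hA hX

theorem exists_eq_map_singleton {us : List (List Name)} (h : ∀ u ∈ us, u.length = 1) :
    ∃ as : List Name, us = as.map ([·]) := by
  induction us with
  | nil => exact ⟨[], rfl⟩
  | cons u us ih =>
    obtain ⟨as, rfl⟩ := ih fun u hu => h u (List.mem_cons_of_mem _ hu)
    obtain ⟨a, rfl⟩ := List.length_eq_one_iff.1 (h u List.mem_cons_self)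
    exact ⟨a :: as, rfl⟩

theorem map_eq_of_forall_mem_zip {s u : List Name} {f : Name → Name} (hl : s.length = u.length)
    (h : ∀ q ∈ s.zip u, f q.1 = q.2) : s.map f = u := by
  induction s generalizing u with
  | nil => simpa using hl.symm
  | cons x s ih =>
    cases u with
    | nil => simp at hl
    | cons a u =>
      rw [List.zip_cons_cons, List.forall_mem_cons] at h
      rw [List.map_cons, ih (by simpa using hl) h.2, h.1]

/-- The values in a consistent state are the values of the solutions. -/
theorem IsState.exists_values (h : IsState A B A' B' views P p V) (hI : IsInstance A B)
    (hr : IsRestriction A B O A' B') (htp : TpCovered A O views) (hc : IsConsistent V)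
    (hP : ∀ Y ∈ P, Y ∈ O) {X : Name} (hX : X ∈ O) :
    ∃ as : List Name, domRel (.dom X) V = as.map ([·]) ∧
      ∀ a, a ∈ as ↔ ∃ f, Str.IsHom f A.toStr B.toStr ∧ P.map f = p ∧ f X = a := by
  obtain ⟨w, hw, hwX, hd⟩ := h.isFamily.exists_domRel_eq hr.isInstance.1 (hr.dom_mem X hX)
  obtain ⟨as, has⟩ := exists_eq_map_singleton (us := w.2) fun u hu => by
    simpa [hwX] using h.isFamily.hasArities w hw u hu
  refine ⟨as, hd.trans has, fun a => ?_⟩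
  have ha : a ∈ as ↔ [a] ∈ w.2 := by simp [has]
  rw [ha]
  constructor
  · intro ha
    have hne : ∀ w' ∈ V, w'.2 ≠ [] := fun w' hw' =>
      hc.ne_nil hw (List.ne_nil_of_mem ha) hw'
    obtain ⟨f, h₁, h₂, h₃⟩ := (exists_hom_of_isConsistent hI hr h.isFamily hc
      -- The solution found for `a` takes values in every view whose scope is a single output
      -- variable, in particular in the pinned ones; so it has the prescribed values on `P`.
      (h.map_fst.symm ▸ htp) hne).2 X hX w hw hwX a ha
    refine ⟨f, h₁, map_eq_of_forall_mem_zip h.length_eq fun q hq => ?_, h₂⟩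
    obtain ⟨w', hw', hwY, hu⟩ := h.pinned q hq
    have hY : q.1 ∈ O := hP _ (List.of_mem_zip (a := q.1) (b := q.2) hq).1
    exact (List.cons.inj (hu _ (h₃ q.1 hY w' hw' hwY))).1
  · rintro ⟨f, h₁, h₂, rfl⟩
    simpa [hwX] using h.carries f h₁ h₂ w hw

theorem size_domRel_le (R : Sym) (V : List Table) :
    (encRel (domRel R V)).size ≤ (encList Table.enc V).size := by
  induction V with
  | nil => simp [domRel]
  | cons w V ih =>
    simp only [domRel]
    split_ifs <;> simp [Table.enc] <;> omega

theorem size_ofList_le_encRel (as : List Name) :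
    (Data.ofList as).size ≤ (encRel (as.map ([·]))).size := by
  induction as with
  | nil => simp
  | cons a as ih => simp; omega

/-- The run of `propagate` with at least one variable that is not fixed. -/
theorem run_propagate {T H N M : ℕ} (hI : IsInstance A B) (hr : IsRestriction A B O A' B')
    (hO : O.Nodup) (htp : TpCovered A O views) (hH : 60 * (N + 1) + 3 * cst 7 N ≤ H)
    (hN : 3 * M + 2 * (Data.ofList O).size + O.length * M + 30 < N) (X : Name) (Q : List Name)
    (hPQ : O = P ++ X :: Q) (h : IsState A B A' B' views P p V)
    (hV : (encList Table.enc V).size ≤ M) (hp : (Data.ofList p).size ≤ p.length * M + 1)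
    (hT : 4 * ((Q.length + 1) * H) ≤ T) :
    ∃ v t, Run (computeAllSolutions dm) (.inr .propagate)
      (.cons (Data.ofList (X :: Q)) (.cons (encList Table.enc V) (Data.ofList p))) v t ∧
      (extensions A B O P p = ∅ → ∃ k ≤ 2 * H, t = ticks k) ∧
      ((extensions A B O P p).Nonempty →
        Enumerates T (2 * ((Q.length + 1) * H)) (2 * ((Q.length + 1) * H)) t
          (extensions A B O P p)) := by
  -- Each level fixes one more variable and adds `2 * H` to the silent time at either end; the
  -- bounds `M` and `T` are the same for all levels.
  induction hn : Q.length using Nat.strong_induction_on generalizing P p V X Q with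
  | _ n ih =>
  subst hn
  have hA := hr.isInstance.1
  have hXO : X ∈ O := by simp [hPQ]
  have hPO : ∀ Y ∈ P, Y ∈ O := fun Y hY => by simp [hPQ, hY]
  have hO' : O = (P ++ [X]) ++ Q := by simp [hPQ]
  have hXP : X ∉ P := fun hXP => by
    rw [hPQ] at hO
    exact (List.nodup_append.1 hO).2.2 X hXP X List.mem_cons_self rfl
  have hlen : O.length = p.length + 1 + Q.length := by simp [hPQ, h.length_eq]; omega
  have hpM : (Data.ofList p).size ≤ O.length * M + 1 :=
    hp.trans (Nat.add_le_add_right (Nat.mul_le_mul_right _ (by omega)) _)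
  have hsO : (Data.ofList (X :: Q)).size ≤ (Data.ofList O).size :=
    Data.size_ofList_le_of_sublist (hPQ ▸ List.sublist_append_right _ _)
  obtain ⟨m, hc, k, hk, hgac⟩ := computes_gac dm (N := N) V (by omega)
  set V' := (fun V => reviseRels V V)^[m] V with hV'
  have h' : IsState A B A' B' views P p V' := iterate_revise (fun _ h => h.revise) m h
  have hVM : (encList Table.enc V').size ≤ M :=
    iterate_revise (P := fun V => (encList Table.enc V).size ≤ M)
      (fun V h => (size_reviseRels_le V V).trans h) m hV
  obtain ⟨as, hdom, has⟩ := h'.exists_values hI hr htp hc hPO hXO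
  have hdM := (size_domRel_le (.dom X) V').trans hVM
  rw [hdom] at hdM
  have hasM := (size_ofList_le_encRel as).trans hdM
  have hddM := Data.size_ofList_le_of_sublist as.dedup_sublist
  have hXs : X.size + 1 < (Data.ofList O).size := Data.size_lt_of_mem hXO
  obtain ⟨k₁, hk₁, hdomRel⟩ := computes_domRel dm (N := N) (.dom X) V'
    (by simp [encSym]; omega)
  obtain ⟨k₂, hk₂, hvalues⟩ := computes_values dm (N := N) as (by omega)
  rw [hdom] at hdomRel
  -- With `J = 2 * (Q.length * H)` from the level below, `2 * J + 4 * H` is exactly `4 * ((Q.length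
  -- + 1) * H)`.
  have hT' : 2 * (2 * (Q.length * H)) + 4 * H ≤ T := by
    rw [add_mul] at hT
    omega
  have hmem : ∀ a, a ∈ as.dedup ↔
      ∃ f, Str.IsHom f A.toStr B.toStr ∧ P.map f = p ∧ f X = a := fun a => by
    rw [List.mem_dedup, has]
  have hmap : ∀ f a, (P ++ [X]).map f = p ++ [a] ↔ P.map f = p ∧ f X = a := fun f a => by
    rw [List.map_append]
    constructor
    · intro hf
      obtain ⟨h₁, h₂⟩ := List.append_inj hf (by simp [h.length_eq])
      exact ⟨h₁, by simpa using h₂⟩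
    · rintro ⟨rfl, rfl⟩
      rfl
  obtain ⟨v, t, hfor, ht⟩ := run_forEach dm (T := T) (J := 2 * (Q.length * H)) hH hT' X Q V' p
    (fun a => extensions A B O (P ++ [X]) (p ++ [a])) as.dedup as.nodup_dedup
    (by
      rintro rfl a ha
      obtain ⟨f, hf, hfP⟩ := (hmem a).1 ha
      ext q
      rw [List.append_nil] at hO'
      simp only [extensions, ← hO', Set.mem_ofPred_eq, Set.mem_singleton_iff]
      constructor
      · rintro ⟨f, -, rfl, h⟩
        exact h
      · rintro rfl
        refine ⟨f, hf, ?_, ?_⟩ <;> simp [hO', hfP])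
    (by
      intro hQ a ha
      obtain ⟨Y, Q', rfl⟩ := List.exists_cons_of_ne_nil hQ
      have ha' : [a] ∈ domRel (.dom X) V' := by
        rw [hdom]
        exact List.mem_map_of_mem (List.mem_dedup.1 ha)
      -- A value occurs in a relation of size at most `M`, so appending it to `p` costs at most `M`.
      have haM := Data.size_lt_of_mem (List.mem_dedup.1 ha)
      have hs := Data.size_ofList_append p [a]
      simp only [Data.ofList_cons, Data.size_cons, Data.ofList_nil, Data.size_nil] at hs
      obtain ⟨v, t, hrun, -, ht⟩ := ih Q'.length (by simp) Y Q' hO'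
        (h'.fix hA (hr.dom_mem X hXO) hXP ha') ((size_fixRel_le_of_mem ha').trans hVM)
        (by simp only [List.length_append, List.length_singleton, add_mul]; omega)
        (by simp only [List.length_cons, add_mul] at hT ⊢; omega) rfl
      -- No dead end: `a` is the value of `X` in a solution that extends `p`, so the recursive call
      -- has something to output.
      refine ⟨v, t, hrun, ht ?_⟩
      obtain ⟨f, hf, hfP⟩ := (hmem a).1 ha
      exact ⟨O.map f, f, hf, rfl, (hmap f a).2 hfP⟩)
    (by
      -- As `X` is an output variable, its value can be read off from the output tuple.
      rintro a - b - hab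
      rw [Set.disjoint_left]
      rintro q ⟨f, -, rfl, hf⟩ ⟨g, -, hfg, hg⟩
      apply hab
      rw [← ((hmap f a).1 hf).2, ← ((hmap g b).1 hg).2]
      exact List.map_inj_left.1 hfg X hXO)
    (by
      simp only [Data.ofList_cons, Data.size_cons] at hsO
      omega)
  have hS : {q | ∃ a ∈ as.dedup, q ∈ extensions A B O (P ++ [X]) (p ++ [a])} =
      extensions A B O P p := by
    ext q
    constructor
    · rintro ⟨a, -, f, hf, rfl, hfP⟩
      exact ⟨f, hf, rfl, ((hmap f a).1 hfP).1⟩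
    · rintro ⟨f, hf, rfl, hfP⟩
      exact ⟨f X, (hmem _).2 ⟨f, hf, hfP, rfl⟩, f, hf, rfl, (hmap f _).2 ⟨hfP, rfl⟩⟩
  rw [hS] at ht
  have c₂ : 3 * cst 1 N + 60 * (N + 1) ≤ cst 2 N := cst_le_succ 1 N
  have c₃ : 3 * cst 2 N + 60 * (N + 1) ≤ cst 3 N := cst_le_succ 2 N
  have c₄ : 3 * cst 3 N + 60 * (N + 1) ≤ cst 4 N := cst_le_succ 3 N
  have c₅ : 3 * cst 4 N + 60 * (N + 1) ≤ cst 5 N := cst_le_succ 4 N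
  have c₆ : 3 * cst 5 N + 60 * (N + 1) ≤ cst 6 N := cst_le_succ 5 N
  have c₇ : 3 * cst 6 N + 60 * (N + 1) ≤ cst 7 N := cst_le_succ 6 N
  suffices H : ∃ v t', Run (computeAllSolutions dm) (.inr .propagate)
      (.cons (Data.ofList (X :: Q)) (.cons (encList Table.enc V) (Data.ofList p))) v t' ∧
      ∃ n ≤ H, t' = ticks n ++ t by
    obtain ⟨v, _, hrun, n, hn, rfl⟩ := H
    refine ⟨v, _, hrun, fun hE => ?_, fun hne => ?_⟩
    · rcases ht with ⟨-, k, hk, rfl⟩ | ⟨hne, -⟩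
      · exact ⟨n + k, by omega, ticks_append _ _⟩
      · obtain ⟨a, ha⟩ := List.exists_mem_of_ne_nil _ hne
        obtain ⟨f, hf, hfP, -⟩ := (hmem a).1 ha
        exact absurd (show O.map f ∈ extensions A B O P p from ⟨f, hf, rfl, hfP⟩) (by simp [hE])
    · rcases ht with ⟨hnil, -⟩ | ⟨-, ht⟩
      · obtain ⟨_, f, hf, -, hfP⟩ := hne
        have := (hmem (f X)).2 ⟨f, hf, hfP, rfl⟩
        simp [hnil] at this
      · rw [add_mul]
        exact (ht.ticks_append (a' := 2 * (Q.length * H) + 2 * H) (by omega)).mono (by omega)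
          (by omega)
  apply run_of_traced
  simp [encSym] at hgac hdomRel hfor hsO ⊢
  refine ⟨_, _, hgac, _, _, hdomRel, _, _, hvalues, _, _, hfor, ?_⟩
  simp only [ticks_append_ticks_append]
  refine ⟨_, ?_, rfl⟩
  omega

/-- The run of `propagate` with the empty set of output variables. -/
theorem run_propagate_nil {T H N M : ℕ} (hI : IsInstance A B) (hr : IsRestriction A B [] A' B')
    (htp : TpCovered A [] views) (hH : 60 * (N + 1) + 3 * cst 7 N ≤ H)
    (hN : 3 * M + 30 < N) (h : IsState A B A' B' views [] [] V)
    (hV : (encList Table.enc V).size ≤ M) (hT : 2 * H ≤ T) :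
    ∃ v t, Run (computeAllSolutions dm) (.inr .propagate)
      (.cons .nil (.cons (encList Table.enc V) .nil)) v t ∧
      (solutions A B [] = ∅ → ∃ k ≤ 2 * H, t = ticks k) ∧
      ((solutions A B []).Nonempty → Enumerates T (2 * H) (2 * H) t (solutions A B [])) := by
  obtain ⟨m, hc, k, hk, hgac⟩ := computes_gac dm (N := N) V (by omega)
  set V' := (fun V => reviseRels V V)^[m] V with hV'
  have h' : IsState A B A' B' views [] [] V' := iterate_revise (fun _ h => h.revise) m h
  have hVM : (encList Table.enc V').size ≤ M :=
    iterate_revise (P := fun V => (encList Table.enc V).size ≤ M)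
      (fun V h => (size_reviseRels_le V V).trans h) m hV
  have c₂ : 3 * cst 1 N + 60 * (N + 1) ≤ cst 2 N := cst_le_succ 1 N
  have c₃ : 3 * cst 2 N + 60 * (N + 1) ≤ cst 3 N := cst_le_succ 2 N
  have c₄ : 3 * cst 3 N + 60 * (N + 1) ≤ cst 4 N := cst_le_succ 3 N
  have c₅ : 3 * cst 4 N + 60 * (N + 1) ≤ cst 5 N := cst_le_succ 4 N
  have c₆ : 3 * cst 5 N + 60 * (N + 1) ≤ cst 6 N := cst_le_succ 5 N
  have c₇ : 3 * cst 6 N + 60 * (N + 1) ≤ cst 7 N := cst_le_succ 6 N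
  obtain ⟨k₁, hk₁, hall⟩ := computes_allNonempty dm (N := N) V' (by omega)
  by_cases hne : ∀ w ∈ V', w.2 ≠ []
  · obtain ⟨f, hf, -⟩ := (exists_hom_of_isConsistent hI hr h'.isFamily hc
      (h'.map_fst.symm ▸ htp) hne).1
    have hS : solutions A B [] = {[]} := by
      ext q
      simp only [solutions, List.map_nil, Set.mem_ofPred_eq, Set.mem_singleton_iff]
      exact ⟨fun ⟨_, _, h⟩ => h, fun h => ⟨f, hf, h⟩⟩
    suffices H : ∃ v t', Run (computeAllSolutions dm) (.inr .propagate)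
        (.cons .nil (.cons (encList Table.enc V) .nil)) v t' ∧
        ∃ n ≤ H, ∃ n' ≤ H, t' = ticks n ++ some (Data.ofList []) :: ticks n' by
      obtain ⟨v, _, hrun, n, hn, n', hn', rfl⟩ := H
      refine ⟨v, _, hrun, by simp [hS], fun _ => ?_⟩
      rw [hS]
      exact ((enumerates_single (T := T) (a := H) (b := H) []).append_ticks (b' := 2 * H) (by omega)
        (by omega)).ticks_append (by omega)
    rw [Data.ofProp_pos hne] at hall
    apply run_of_traced
    simp at hgac ⊢
    refine ⟨_, _, hgac, _, _, hall, ?_⟩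
    simp
    refine ⟨_, ?_, _, ?_, rfl⟩ <;> omega
  · have hS : solutions A B [] = ∅ := by
      by_contra hS
      obtain ⟨_, f, hf, -⟩ := Set.nonempty_iff_ne_empty.2 hS
      exact hne fun w hw => List.ne_nil_of_mem (h'.carries f hf rfl w hw)
    rw [Data.ofProp_neg hne] at hall
    simp only [hS, true_implies, Set.not_nonempty_empty, false_implies, and_true]
    apply run_of_traced
    simp at hgac ⊢
    refine ⟨_, _, hgac, _, _, hall, ?_⟩
    simp
    refine ⟨_, ?_, rfl⟩
    omega

end

/-! ## Polynomial bounds -/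

/-- The function is given by a polynomial. -/
def IsPoly (f : ℕ → ℕ) : Prop := ∃ p : Polynomial ℕ, ∀ n, p.eval n = f n

namespace IsPoly

variable {f g : ℕ → ℕ}

theorem const (c : ℕ) : IsPoly fun _ => c := ⟨.C c, by simp⟩

theorem id : IsPoly fun n => n := ⟨.X, by simp⟩

theorem add (hf : IsPoly f) (hg : IsPoly g) : IsPoly fun n => f n + g n := by
  obtain ⟨p, hp⟩ := hf
  obtain ⟨q, hq⟩ := hg
  exact ⟨p + q, by simp [hp, hq]⟩

theorem mul (hf : IsPoly f) (hg : IsPoly g) : IsPoly fun n => f n * g n := by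
  obtain ⟨p, hp⟩ := hf
  obtain ⟨q, hq⟩ := hg
  exact ⟨p * q, by simp [hp, hq]⟩

theorem eval (p : Polynomial ℕ) (hf : IsPoly f) : IsPoly fun n => p.eval (f n) := by
  obtain ⟨q, hq⟩ := hf
  exact ⟨p.comp q, by simp [hq]⟩

theorem cst (k : ℕ) (hf : IsPoly f) : IsPoly fun n => ECSP.cst k (f n) := by
  induction k with
  | zero => exact const 0
  | succ k ih =>
    exact (hf.add (const 1)).mul (((const 60).mul (hf.add (const 1))).add ((const 3).mul ih))

end IsPoly

theorem eval_mono (p : Polynomial ℕ) {m n : ℕ} (h : m ≤ n) : p.eval m ≤ p.eval n := by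
  rw [Polynomial.eval_eq_sum_range, Polynomial.eval_eq_sum_range]
  gcongr

/-! ### The bounds for the whole algorithm, and its run. -/

variable (dm : DecompositionMethod)

/-- The size of the domain-restricted version of an instance of size `n`, at most. -/
def restrictBound (n : ℕ) : ℕ := 5 * n + n * (3 * n + 30) + 1

/-- The size of the views and relations that the decomposition method computes, at most. -/
def viewBound (p q : Polynomial ℕ) (n : ℕ) : ℕ :=
  p.eval (restrictBound n) + q.eval (restrictBound n + 1)

/-- A bound for the sizes of the arguments of the procedures. -/
def argBound (p q : Polynomial ℕ) (n : ℕ) : ℕ :=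
  3 * viewBound p q n + 2 * n + n * viewBound p q n + 31

/-- A bound for the time of the preprocessing. -/
def initBound (p q : Polynomial ℕ) (n : ℕ) : ℕ :=
  cst 4 (restrictBound n) + viewBound p q n + cst 1 (viewBound p q n + 1) +
    60 * (n + restrictBound n + viewBound p q n + 1)

/-- A bound for the delay. -/
def delayBound (p q : Polynomial ℕ) (n : ℕ) : ℕ :=
  initBound p q n + 4 * ((n + 1) * cst 8 (argBound p q n))

theorem isPoly_delayBound (p q : Polynomial ℕ) : IsPoly (delayBound p q) := by
  have h₁ : IsPoly restrictBound :=
    (((IsPoly.const 5).mul .id).add (IsPoly.id.mul (((IsPoly.const 3).mul .id).add (.const 30)))).add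
      (.const 1)
  have h₂ : IsPoly (viewBound p q) := (h₁.eval p).add ((h₁.add (.const 1)).eval q)
  have h₃ : IsPoly (argBound p q) :=
    ((((IsPoly.const 3).mul h₂).add ((IsPoly.const 2).mul .id)).add (IsPoly.id.mul h₂)).add
      (.const 31)
  exact ((((h₁.cst 4).add h₂).add ((h₂.add (.const 1)).cst 1)).add
    ((IsPoly.const 60).mul (((IsPoly.id.add h₁).add h₂).add (.const 1)))).add
    ((IsPoly.const 4).mul ((IsPoly.id.add (.const 1)).mul (h₃.cst 8)))

/-- The run of the algorithm. -/
theorem enumerates_computeAll {p q : Polynomial ℕ}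
    (hp : ∀ A, A.IsLeft → ComputesWithin dm.code dm.leftProc A.enc
      (encList View.enc (dm.left A)) (p.eval A.enc.size))
    (hq : ∀ A B, IsInstance A B → ComputesWithin dm.code dm.rightProc (.cons A.enc B.enc)
      (encList encRel (dm.right A B)) (q.eval (Data.cons A.enc B.enc).size))
    {A B : FinStr} {O : List Name} (hI : IsInstance A B) (hO : O.Nodup)
    (hOA : ∀ X ∈ O, X ∈ A.univ) (htp : TpCovered A O (dm.left (A.domRestrict O))) :
    EnumeratesWithDelay (computeAllSolutions dm) (.inr .computeAll) (encInstance A B O)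
      (solutions A B O) (delayBound p q (encInstance A B O).size) := by
  have hn : (encInstance A B O).size = 2 + A.enc.size + B.enc.size + (Data.ofList O).size := by
    simp [encInstance]; omega
  set n := (encInstance A B O).size with hn'
  have hlen := Data.length_lt_size O
  obtain ⟨hrun, hsize⟩ := restrictPair_cost dm (N := restrictBound n) hI hOA B.relsBounded_enc (by
    have : O.length * (3 * B.enc.size + 30) ≤ n * (3 * n + 30) :=
      Nat.mul_le_mul (by omega) (by omega)
    simp only [restrictBound]
    omega)
  have hr := isRestriction_restrictPair hI hOA
  rw [restrictPair_fst] at hrun hsize hr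
  set A' := A.domRestrict O with hA'
  set B' := (restrictPair O A B).2 with hB'
  have hl := (hp A' hr.isInstance.1).map Sum.inl (code' := computeAllSolutions dm) fun _ => rfl
  have hr' := (hq A' B' hr.isInstance).map Sum.inl (code' := computeAllSolutions dm) fun _ => rfl
  replace hl := hl.mono (eval_mono p (show _ ≤ restrictBound n by omega))
  replace hr' := hr'.mono (eval_mono q (show _ ≤ restrictBound n + 1 by simp; omega))
  -- The sizes of the computed views and relations are bounded by the time it took to build them.
  have hM : (encList View.enc (dm.left A')).size + (encList encRel (dm.right A' B')).size ≤
      viewBound p q n := Nat.add_le_add hl.size_le hr'.size_le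
  have hzs := size_zip_le (dm.left A') (dm.right A' B')
  have hz := computes_zip dm (N := viewBound p q n + 1) (dm.left A') (dm.right A' B') (by omega)
  have hleg := dm.right_isLegal A' B' hr.isInstance
  have hstate : IsState A B A' B' (dm.left A') [] [] ((dm.left A').zip (dm.right A' B')) :=
    { isFamily := hleg.isFamily (dm.left_isViewStructure A' hr.isInstance.1)
      map_fst := List.map_fst_zip hleg.1.le
      length_eq := rfl
      carries := fun f hf _ => hleg.carries ((hr.isHom_iff f).2 hf)
      pinned := by simp }
  set H := cst 8 (argBound p q n) with hH
  have hH' : 60 * (argBound p q n + 1) + 3 * cst 7 (argBound p q n) ≤ H :=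
    (Nat.add_comm _ _).trans_le (cst_le_succ 7 (argBound p q n))
  set T := delayBound p q n with hT
  have hT' : T = initBound p q n + 4 * ((n + 1) * H) := rfl
  -- The encoding of `O` has more nodes than `O` has entries, so the depth of the recursion is less
  -- than `n`.
  have hOn : (O.length + 1) * H ≤ n * H := Nat.mul_le_mul_right _ (by omega)
  rw [add_mul] at hOn
  rw [add_mul] at hT'
  have key : ∃ v t, Run (computeAllSolutions dm) (.inr .propagate)
      (.cons (Data.ofList O) (.cons (encList Table.enc ((dm.left A').zip (dm.right A' B'))) .nil)) v t ∧
      (solutions A B O = ∅ → ∃ k ≤ 2 * H, t = ticks k) ∧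
      ((solutions A B O).Nonempty →
        Enumerates T (2 * (n * H)) (2 * (n * H)) t (solutions A B O)) := by
    cases O with
    | nil =>
      obtain ⟨v, t, h₁, h₂, h₃⟩ := run_propagate_nil dm (T := T) (M := viewBound p q n) hI hr htp hH'
        (by simp only [argBound]; omega) hstate (by omega) (by omega)
      exact ⟨v, t, h₁, h₂, fun h => (h₃ h).mono (by omega) (by omega)⟩
    | cons X Q =>
      have hE : extensions A B (X :: Q) [] [] = solutions A B (X :: Q) := by
        ext q; simp [extensions, solutions]
      have hmul : (X :: Q).length * viewBound p q n ≤ n * viewBound p q n :=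
        Nat.mul_le_mul_right _ (by omega)
      simp only [List.length_cons] at hOn
      obtain ⟨v, t, h₁, h₂, h₃⟩ := run_propagate dm (T := T) (M := viewBound p q n) (P := []) (p := [])
        hI hr hO htp hH' (by simp only [argBound]; omega) X Q rfl hstate (by omega) (by simp)
        (by omega)
      rw [hE] at h₂ h₃
      exact ⟨v, t, h₁, h₂, fun h => (h₃ h).mono (by omega) (by omega)⟩
  obtain ⟨v, t, hprop, ht₁, ht₂⟩ := key
  obtain ⟨k₁, hk₁, hrun⟩ := hrun
  obtain ⟨k₂, hk₂, hl⟩ := hl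
  obtain ⟨k₃, hk₃, hr'⟩ := hr'
  obtain ⟨k₄, hk₄, hz⟩ := hz
  have hvb : viewBound p q n = p.eval (restrictBound n) + q.eval (restrictBound n + 1) := rfl
  suffices H : ∃ v t', Run (computeAllSolutions dm) (.inr .computeAll) (encInstance A B O) v t' ∧
      ∃ k ≤ initBound p q n, t' = ticks k ++ t by
    obtain ⟨v, _, hrun, k, hk, rfl⟩ := H
    -- Without solutions the whole run is one silent stretch; otherwise the preprocessing only
    -- lengthens the stretch before the first output.
    rcases Set.eq_empty_or_nonempty (solutions A B O) with hS | hS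
    · obtain ⟨m, hm, rfl⟩ := ht₁ hS
      rw [ticks_append] at hrun
      rw [hS]
      exact (enumerates_ticks (T := T) (a := k + m) (b := T) le_rfl (by omega)).enumeratesWithDelay
        (by omega) hrun
    · exact ((ht₂ hS).ticks_append (a' := T) (by omega)).enumeratesWithDelay le_rfl hrun
  apply run_of_traced
  simp [encInstance]
  refine ⟨_, _, hrun, ?_⟩
  refine ⟨_, _, hl, _, _, hr', _, _, hz, _, _, hprop, ?_⟩
  simp only [ticks_append_ticks_append]
  refine ⟨_, ?_, rfl⟩
  simp only [initBound, Data.size_cons]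
  omega

end ECSP

theorem mainTheorem2 (dm : ECSP.DecompositionMethod) :
    ∃ p : Polynomial ℕ, ∀ (A B : ECSP.FinStr) (O : List ECSP.Name),
      ECSP.IsInstance A B → O.Nodup → (∀ X ∈ O, X ∈ A.univ) →
      ECSP.TpCovered A O (dm.left (A.domRestrict O)) →
      ECSP.EnumeratesWithDelay (ECSP.computeAllSolutions dm) (Sum.inr ECSP.Proc.computeAll)
        (ECSP.encInstance A B O) (ECSP.solutions A B O)
        (p.eval (ECSP.encInstance A B O).size) := by
  obtain ⟨p, hp⟩ := dm.left_polynomial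
  obtain ⟨q, hq⟩ := dm.right_polynomial
  obtain ⟨r, hr⟩ := ECSP.isPoly_delayBound p q
  refine ⟨r, fun A B O hI hO hOA htp => ?_⟩
  rw [hr]
  exact ECSP.enumerates_computeAll dm hp hq hI hO hOA htp
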